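/- **Theorem 4.6.** Let $p$ and $q$ be distinct primes with $p\equiv 1\pmod 8$ and $q\equiv 1\pmod 8$. Suppose that $p=c^2+d^2=x^2+2qy^2$ and $q=a^2+b^2$ with $a,b,c,d,x,y\in\mathbb Z$, where $c\equiv 1\pmod 4$ and $d=2^r d_0$ for some integers $r\ge 0$ and $d_0$ with $d_0\equiv 1\pmod 4$. Assume that $\gcd(c,x+d)=1$ or $\gcd(d_0,x+c)=1$. Then for every integer $m$, $$(-q)^{\frac{p-1}{8}}\equiv(-1)^{\frac d4+\frac y2}\left(\frac dc\right)^m \pmod p \quad\Longleftrightarrow\quad \left(\frac{ac+bd}{ac-bd}\right)^{\frac{q-1}{8}}\equiv\left(\frac ba\right)^m \pmod q,$$ where the fractions in parentheses denote quotients of residue classes in the fields $\mathbb Z/p\mathbb Z$ and $\mathbb Z/q\mathbb Z$ (they are not Legendre symbols). The hypotheses imply that $4\mid d$, $2\mid y$, $p\nmid c$, $q\nmid a$ and $q\nmid ac-bd$, so all expressions are defined. -/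

import Mathlib

/-!
The quartic residue symbol `χ_α(β)` of the Gaussian integers, a power of `i` for coprime `α` and `β`
with `α` odd, obeys a reciprocity law when one of its arguments is a rational integer.

Put `π = c + d i`. Modulo `π`, the representation `p = x² + 2 q y²` makes `-q`, up to a power of
`i`, the square of `x / ((1 - i) y)`, so `(-q) ^ ((p - 1) / 8)` is given by the symbols of `x`, `y`
and `1 - i` modulo `π`. Modulo `q`, it gives `N(π) ≡ x²`, so `i ^ j π` divided by its conjugate is
the square of `i ^ j π + x` divided by its conjugate, and `((ac + bd) / (ac - bd)) ^ ((q - 1) / 8)`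
is, up to a power of `i`, the symbol of `i ^ j π + x` modulo `q`. Either gcd condition provides a
`j` for which this symbol can be computed by reciprocity, and the symbols of `x` and `y` appear
again.
Apart from the sign in the first congruence, both residues are therefore the same power `T` of the
images of `i` in the two prime fields, and both congruences say that `T ≡ m` modulo `4`.
-/

namespace QuarticSymbol

open UniqueFactorizationMonoid

/-! ### Powers of the imaginary unit -/

/-- The imaginary unit `i` of the Gaussian integers, as a unit so that it has integer powers. -/
def iUnit : GaussianIntˣ := ⟨⟨0, 1⟩, ⟨0, -1⟩, by decide, by decide⟩

/-- The power `i ^ k` of the imaginary unit for an integer `k`. The values of the quartic symbols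
at coprime arguments are written in this form, which turns identities between symbols into
congruences modulo `4`. -/
def iPow (k : ℤ) : GaussianInt := (iUnit ^ k : GaussianIntˣ)

lemma iPow_zero : iPow 0 = 1 := by rw [iPow, zpow_zero, Units.val_one]

lemma iPow_one : iPow 1 = ⟨0, 1⟩ := by rw [iPow, zpow_one]; rfl

lemma iPow_add (a b : ℤ) : iPow (a + b) = iPow a * iPow b := by
  rw [iPow, zpow_add, Units.val_mul]; rfl

lemma iPow_mul (a : ℤ) (n : ℕ) : iPow (a * n) = iPow a ^ n := by
  rw [iPow, zpow_mul, zpow_natCast, Units.val_pow_eq_pow_val]; rfl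

lemma iPow_congr {a b : ℤ} (h : a ≡ b [ZMOD 4]) : iPow a = iPow b := by
  have h4 : iUnit ^ (4 : ℤ) = 1 := by ext <;> decide
  obtain ⟨k, hk⟩ := h.dvd
  obtain rfl : b = a + 4 * k := by omega
  rw [iPow, iPow, zpow_add, zpow_mul, h4, one_zpow, mul_one]

lemma iPow_two : iPow 2 = -1 := by
  rw [show (2 : ℤ) = 1 + 1 by norm_num, iPow_add, iPow_one]; decide

lemma iPow_three : iPow 3 = ⟨0, -1⟩ := by
  rw [show (3 : ℤ) = 1 + 2 by norm_num, iPow_add, iPow_one, iPow_two]; decide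

lemma isUnit_iPow (k : ℤ) : IsUnit (iPow k) := Units.isUnit _

lemma iPow_cases (k : ℤ) : (k % 4 = 0 ∧ iPow k = 1) ∨ (k % 4 = 1 ∧ iPow k = ⟨0, 1⟩) ∨
    (k % 4 = 2 ∧ iPow k = -1) ∨ (k % 4 = 3 ∧ iPow k = ⟨0, -1⟩) := by
  have h : k % 4 = 0 ∨ k % 4 = 1 ∨ k % 4 = 2 ∨ k % 4 = 3 := by omega
  rcases h with h | h | h | h
  · exact .inl ⟨h, (iPow_congr (b := 0) h).trans iPow_zero⟩
  · exact .inr (.inl ⟨h, (iPow_congr (b := 1) h).trans iPow_one⟩)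
  · exact .inr (.inr (.inl ⟨h, (iPow_congr (b := 2) h).trans iPow_two⟩))
  · exact .inr (.inr (.inr ⟨h, (iPow_congr (b := 3) h).trans iPow_three⟩))

lemma star_iPow (k : ℤ) : star (iPow k) = iPow (-k) := by
  refine (isUnit_iPow k).mul_left_cancel ?_
  rw [← iPow_add, add_neg_cancel, iPow_zero, ← Zsqrtd.norm_eq_mul_conj,
    (Zsqrtd.norm_eq_one_iff' (by norm_num) _).2 (isUnit_iPow k), Int.cast_one]

lemma exists_eq_iPow_of_isUnit {u : GaussianInt} (h : IsUnit u) : ∃ k, u = iPow k := by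
  have hnorm := (Zsqrtd.norm_eq_one_iff' (by norm_num) u).2 h
  obtain ⟨x, y⟩ := u
  simp only [Zsqrtd.norm_def] at hnorm
  obtain ⟨hx1, hx2⟩ : -1 ≤ x ∧ x ≤ 1 := by constructor <;> nlinarith [sq_nonneg x, sq_nonneg y]
  obtain ⟨hy1, hy2⟩ : -1 ≤ y ∧ y ≤ 1 := by constructor <;> nlinarith [sq_nonneg x, sq_nonneg y]
  interval_cases x <;> interval_cases y <;> norm_num at hnorm
  · exact ⟨2, by rw [iPow_two]; rfl⟩
  · exact ⟨3, by rw [iPow_three]⟩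
  · exact ⟨1, by rw [iPow_one]⟩
  · exact ⟨0, by rw [iPow_zero]; rfl⟩

section Map

variable {K : Type*} [CommRing K] (f : GaussianInt →+* K)

lemma map_iPow_eq_one_iff (h2 : (2 : K) ≠ 0) {k : ℤ} : f (iPow k) = 1 ↔ k ≡ 0 [ZMOD 4] := by
  refine ⟨fun h => ?_, fun h => by rw [iPow_congr h, iPow_zero, map_one]⟩
  have hneg : (-1 : K) ≠ 1 := fun h => h2 (by linear_combination -h)
  have hsq : f (iPow k) ^ 2 = 1 := by rw [h, one_pow]
  rw [← map_pow] at hsq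
  rcases iPow_cases k with ⟨hk, -⟩ | ⟨-, e⟩ | ⟨-, e⟩ | ⟨-, e⟩
  · exact hk
  · rw [e, show (⟨0, 1⟩ : GaussianInt) ^ 2 = -1 by decide, map_neg, map_one] at hsq
    exact absurd hsq hneg
  · rw [e, map_neg, map_one] at h
    exact absurd h hneg
  · rw [e, show (⟨0, -1⟩ : GaussianInt) ^ 2 = -1 by decide, map_neg, map_one] at hsq
    exact absurd hsq hneg

variable [IsDomain K]

lemma map_iPow_inj (h2 : (2 : K) ≠ 0) {a b : ℤ} :
    f (iPow a) = f (iPow b) ↔ a ≡ b [ZMOD 4] := by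
  have e : f (iPow a) = f (iPow (a - b)) * f (iPow b) := by
    rw [← map_mul, ← iPow_add, sub_add_cancel]
  have hu : f (iPow b) ≠ 0 := ((isUnit_iPow b).map f).ne_zero
  rw [e, mul_eq_right₀ hu, map_iPow_eq_one_iff f h2, Int.modEq_zero_iff_dvd,
    ← Int.modEq_iff_dvd]
  exact ⟨Int.ModEq.symm, Int.ModEq.symm⟩

lemma exists_eq_map_iPow_of_pow_four_eq_one {z : K} (hz : z ^ 4 = 1) : ∃ k, z = f (iPow k) := by
  have hi : f ⟨0, 1⟩ ^ 2 = -1 := by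
    rw [← map_pow, show (⟨0, 1⟩ : GaussianInt) ^ 2 = -1 by decide, map_neg, map_one]
  have hfactor : (z - 1) * (z + 1) * ((z - f ⟨0, 1⟩) * (z + f ⟨0, 1⟩)) = 0 := by
    linear_combination hz - (z ^ 2 - 1) * hi
  rcases mul_eq_zero.1 hfactor with h | h <;> rcases mul_eq_zero.1 h with h | h
  · exact ⟨0, by rw [iPow_zero, map_one, sub_eq_zero.1 h]⟩
  · exact ⟨2, by rw [iPow_two, map_neg, map_one, eq_neg_of_add_eq_zero_left h]⟩
  · exact ⟨1, by rw [iPow_one, sub_eq_zero.1 h]⟩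
  · exact ⟨3, by
      rw [iPow_three, show (⟨0, -1⟩ : GaussianInt) = -⟨0, 1⟩ by decide, map_neg,
        eq_neg_of_add_eq_zero_left h]⟩

end Map

lemma iPow_inj {a b : ℤ} : iPow a = iPow b ↔ a ≡ b [ZMOD 4] :=
  map_iPow_inj (RingHom.id GaussianInt) two_ne_zero

/-! ### Odd Gaussian primes and their residue fields -/

lemma norm_mod_four {z : GaussianInt} (h : Odd z.norm) : z.norm % 4 = 1 := by
  obtain ⟨x, y⟩ := z
  simp only [Zsqrtd.norm_def, neg_mul, one_mul, sub_neg_eq_add, ← pow_two] at h ⊢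
  obtain ⟨a, rfl | rfl⟩ := Int.even_or_odd' x <;> obtain ⟨b, rfl | rfl⟩ := Int.even_or_odd' y <;>
    ring_nf at h ⊢ <;> rw [Int.odd_iff] at h <;> omega

lemma four_mul_natAbs_norm_sub_one_div {z : GaussianInt} (h : Odd z.norm) :
    4 * ((z.norm.natAbs - 1) / 4) = z.norm.natAbs - 1 := by
  have := norm_mod_four h
  have := GaussianInt.norm_nonneg z
  omega

lemma norm_dvd_norm {a b : GaussianInt} (h : a ∣ b) : a.norm ∣ b.norm :=
  map_dvd Zsqrtd.normMonoidHom h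

lemma ne_zero_of_odd_norm {α : GaussianInt} (h : Odd α.norm) : α ≠ 0 := by
  rintro rfl
  exact absurd h (by decide)

lemma odd_norm_mul {α β : GaussianInt} : Odd (α * β).norm ↔ Odd α.norm ∧ Odd β.norm := by
  rw [Zsqrtd.norm_mul, Int.odd_mul]

lemma odd_norm_intCast {n : ℤ} : Odd (n : GaussianInt).norm ↔ Odd n := by
  rw [Zsqrtd.norm_intCast, Int.odd_mul, and_self]

lemma not_dvd_two {ϖ : GaussianInt} (hϖ : Prime ϖ) (hodd : Odd ϖ.norm) : ¬ ϖ ∣ 2 := by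
  intro hd
  have hdvd : ϖ.norm ∣ 2 ^ 2 := norm_dvd_norm hd
  have hunit := (Int.isCoprime_two_right.2 hodd).pow_right.isUnit_of_dvd hdvd
  exact hϖ.not_isUnit ((Zsqrtd.isUnit_iff_norm_isUnit ϖ).2 hunit)

lemma mul_star_of_norm_eq {n : ℕ} {ρ : GaussianInt} (hρ : ρ.norm = n) :
    ρ * star ρ = (n : GaussianInt) := by
  rw [← Zsqrtd.norm_eq_mul_conj, hρ, Int.cast_natCast]

lemma prime_of_norm_prime {p : ℕ} (hp : p.Prime) {ϖ : GaussianInt} (hN : ϖ.norm = p) :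
    Prime ϖ := by
  have : IsLocalHom (Zsqrtd.normMonoidHom (d := -1)) :=
    ⟨fun z => (Zsqrtd.isUnit_iff_norm_isUnit z).2⟩
  have hirr : Irreducible (Zsqrtd.normMonoidHom ϖ) := by
    change Irreducible ϖ.norm
    exact hN ▸ (Nat.prime_iff_prime_int.1 hp).irreducible
  exact irreducible_iff_prime.1 hirr.of_map

lemma exists_norm_eq_of_mod_four_eq_one {l : ℕ} (hl : l.Prime) (h1 : l % 4 = 1) :
    ∃ ρ : GaussianInt, ρ.norm = l := by
  have := Fact.mk hl
  obtain ⟨a, b, hab⟩ := Nat.Prime.sq_add_sq (p := l) (by omega)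
  exact ⟨⟨a, b⟩, by rw [Zsqrtd.norm_def]; push_cast [← hab]; ring⟩

lemma associated_of_dvd_of_norm_eq {a b : GaussianInt} (hb : b ≠ 0) (hd : a ∣ b)
    (h : a.norm = b.norm) : Associated a b := by
  obtain ⟨c, rfl⟩ := hd
  rw [Zsqrtd.norm_mul] at h
  have hc : c.norm = 1 := by
    refine (mul_right_eq_self₀.1 h.symm).resolve_right fun h0 => hb ?_
    rw [(Zsqrtd.norm_eq_zero_iff (by norm_num) a).1 h0, zero_mul]
  obtain ⟨u, rfl⟩ := (Zsqrtd.norm_eq_one_iff' (by norm_num) c).1 hc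
  exact ⟨u, rfl⟩

lemma exists_prime_dvd_natCast {ϖ : GaussianInt} (hϖ : Prime ϖ) :
    ∃ l : ℕ, l.Prime ∧ ϖ ∣ (l : GaussianInt) := by
  have h0 : ϖ.norm.natAbs ≠ 0 :=
    Int.natAbs_ne_zero.2 fun h => hϖ.ne_zero (GaussianInt.norm_eq_zero.1 h)
  have hd : ϖ ∣ (ϖ.norm.natAbs : GaussianInt) :=
    ⟨star ϖ, (mul_star_of_norm_eq (GaussianInt.abs_natCast_norm ϖ).symm).symm⟩
  rw [← Nat.prod_primeFactorsList h0, Nat.cast_list_prod] at hd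
  obtain ⟨_, hm, hdvd⟩ := (Prime.dvd_prod_iff hϖ).1 hd
  obtain ⟨l, hl, rfl⟩ := List.mem_map.1 hm
  exact ⟨l, Nat.prime_of_mem_primeFactorsList hl, hdvd⟩

lemma norm_prime_or_associated_natCast {ϖ : GaussianInt} (hϖ : Prime ϖ) (hodd : Odd ϖ.norm) :
    (∃ p : ℕ, p.Prime ∧ p % 4 = 1 ∧ ϖ.norm = p) ∨
      ∃ l : ℕ, l.Prime ∧ l % 4 = 3 ∧ Associated ϖ (l : GaussianInt) := by
  obtain ⟨l, hl, hd⟩ := exists_prime_dvd_natCast hϖ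
  have hcast := GaussianInt.abs_natCast_norm ϖ
  have hnorm : ϖ.norm.natAbs ∣ l ^ 2 := by
    rw [← Int.natCast_dvd_natCast, hcast, pow_two, Nat.cast_mul, ← Zsqrtd.norm_natCast]
    exact norm_dvd_norm hd
  obtain ⟨k, hk, hk'⟩ := (Nat.dvd_prime_pow hl).1 hnorm
  interval_cases k
  · exact absurd (Zsqrtd.norm_eq_one_iff.1 hk') hϖ.not_isUnit
  · rw [pow_one] at hk'
    have := norm_mod_four hodd
    exact .inl ⟨l, hl, by omega, by omega⟩
  · have hassoc : Associated ϖ (l : GaussianInt) := by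
      refine associated_of_dvd_of_norm_eq (Nat.cast_ne_zero.2 hl.ne_zero) hd ?_
      rw [← hcast, hk', Zsqrtd.norm_natCast, Nat.cast_pow, pow_two]
    have := Fact.mk hl
    exact .inr ⟨l, hl, GaussianInt.mod_four_eq_three_of_nat_prime_of_prime l (hassoc.prime hϖ),
      hassoc⟩

lemma map_eq_zero_iff_dvd {K : Type*} [CommRing K] [Nontrivial K] {ϖ : GaussianInt}
    (hϖ : Prime ϖ) (f : GaussianInt →+* K) (h0 : f ϖ = 0) {z : GaussianInt} :
    f z = 0 ↔ ϖ ∣ z := by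
  refine ⟨fun hz => ?_, fun h => zero_dvd_iff.1 (h0 ▸ map_dvd f h)⟩
  by_contra hd
  have hcop := ((hϖ.irreducible.coprime_iff_not_dvd).2 hd).map f
  rw [h0, hz] at hcop
  exact not_isCoprime_zero_zero hcop

lemma exists_hom_zmod {p : ℕ} [Fact p.Prime] {ϖ : GaussianInt} (hN : ϖ.norm = p) :
    (ϖ.re : ZMod p) ≠ 0 ∧ ∃ f : GaussianInt →+* ZMod p,
      f ⟨0, 1⟩ = (ϖ.im : ZMod p) / (ϖ.re : ZMod p) ∧ f ϖ = 0 := by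
  have hp := Nat.prime_iff_prime_int.1 (Fact.out : p.Prime)
  have hN' : (p : ℤ) = ϖ.re ^ 2 + ϖ.im ^ 2 := by rw [← hN, Zsqrtd.norm_def]; ring
  have hsum : (ϖ.re : ZMod p) ^ 2 + (ϖ.im : ZMod p) ^ 2 = 0 := by
    have := congrArg (Int.cast : ℤ → ZMod p) hN'
    push_cast at this
    rw [← this, ZMod.natCast_self]
  have hre : (ϖ.re : ZMod p) ≠ 0 := by
    intro hre
    have him : (ϖ.im : ZMod p) = 0 := by simpa [hre] using hsum
    rw [ZMod.intCast_zmod_eq_zero_iff_dvd] at hre him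
    have hdvd : (p : ℤ) ^ 2 ∣ (p : ℤ) ^ 1 := by
      conv_rhs => rw [pow_one, hN']
      exact dvd_add (pow_dvd_pow_of_dvd hre 2) (pow_dvd_pow_of_dvd him 2)
    exact absurd ((pow_dvd_pow_iff hp.ne_zero hp.not_isUnit).1 hdvd) (by norm_num)
  refine ⟨hre, Zsqrtd.lift ⟨(ϖ.im : ZMod p) / ϖ.re, ?_⟩, ?_, ?_⟩
  · field_simp; push_cast; linear_combination hsum
  · simp [Zsqrtd.lift]
  · simp only [Zsqrtd.lift, Equiv.coe_fn_mk, RingHom.coe_mk, MonoidHom.coe_mk, OneHom.coe_mk]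
    field_simp; linear_combination hsum

/-- For `l ≡ 3 [MOD 4]`, both sides are ring homomorphisms with the same value `-i` at `i`. -/
lemma map_pow_eq_map_star {K : Type*} [CommRing K] {l : ℕ} (hl : l.Prime) (h3 : l % 4 = 3)
    [CharP K l] (f : GaussianInt →+* K) (β : GaussianInt) : f β ^ l = f (star β) := by
  have := Fact.mk hl
  have hi : (⟨0, 1⟩ : GaussianInt) ^ l = star ⟨0, 1⟩ := by
    rw [← iPow_one, ← iPow_mul, star_iPow]
    exact iPow_congr (by rw [Int.ModEq]; omega)
  have hhom : (frobenius K l).comp f = f.comp (starRingEnd GaussianInt) := by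
    apply Zsqrtd.hom_ext
    change f ⟨0, 1⟩ ^ l = f (star ⟨0, 1⟩)
    rw [← map_pow, hi]
  exact DFunLike.congr_fun hhom β

lemma natCast_dvd_pow_sub_star {l : ℕ} (hl : l.Prime) (h3 : l % 4 = 3) (β : GaussianInt) :
    (l : GaussianInt) ∣ β ^ l - star β := by
  have := Fact.mk hl
  have hlp := GaussianInt.prime_of_nat_prime_of_mod_four_eq_three l h3
  have := CharP.quotient GaussianInt l hlp.not_isUnit
  rw [← Ideal.mem_span_singleton, ← Ideal.Quotient.eq, map_pow]
  exact map_pow_eq_map_star hl h3 _ β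

lemma dvd_pow_natAbs_norm_sub_one_sub_one {ϖ : GaussianInt} (hϖ : Prime ϖ) (hodd : Odd ϖ.norm)
    {β : GaussianInt} (hβ : ¬ ϖ ∣ β) : ϖ ∣ β ^ (ϖ.norm.natAbs - 1) - 1 := by
  rcases norm_prime_or_associated_natCast hϖ hodd with ⟨p, hp, -, hN⟩ | ⟨l, hl, h3, ha⟩
  · have := Fact.mk hp
    obtain ⟨-, f, -, hf⟩ := exists_hom_zmod hN
    rw [← map_eq_zero_iff_dvd hϖ f hf] at hβ ⊢
    rw [map_sub, map_pow, map_one, hN, Int.natAbs_natCast, ZMod.pow_card_sub_one_eq_one hβ,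
      sub_self]
  · rw [Zsqrtd.norm_eq_of_associated (by norm_num) ha, ha.dvd_iff_dvd_left]
    rw [ha.dvd_iff_dvd_left] at hβ
    refine ((ha.prime hϖ).dvd_mul.1 ?_).resolve_left hβ
    have hsq : β * (β ^ (l * l - 1) - 1) =
        ((β ^ l) ^ l - star β ^ l) + (star β ^ l - star (star β)) := by
      have : 1 ≤ l * l := Nat.mul_pos hl.pos hl.pos
      rw [mul_sub, ← pow_succ', Nat.sub_add_cancel this, pow_mul, star_star]
      ring
    rw [Zsqrtd.norm_natCast, ← Nat.cast_mul, Int.natAbs_natCast, hsq]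
    exact dvd_add ((natCast_dvd_pow_sub_star hl h3 β).trans (sub_dvd_pow_sub_pow _ _ _))
      (natCast_dvd_pow_sub_star hl h3 (star β))

/-! ### The quartic residue symbol -/

section PrimeModulus

variable {ϖ : GaussianInt}

lemma modEq_of_dvd_iPow_sub_iPow (hϖ : Prime ϖ) (hodd : Odd ϖ.norm) {a b : ℤ}
    (h : ϖ ∣ iPow a - iPow b) : a ≡ b [ZMOD 4] := by
  have := (Ideal.span_singleton_prime hϖ.ne_zero).2 hϖ
  have h2 : (2 : GaussianInt ⧸ Ideal.span {ϖ}) ≠ 0 := fun h0 =>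
    not_dvd_two hϖ hodd ((Ideal.Quotient.eq_zero_iff_dvd _ _).1 h0)
  rw [← map_iPow_inj (Ideal.Quotient.mk (Ideal.span {ϖ})) h2, Ideal.Quotient.eq,
    Ideal.mem_span_singleton]
  exact h

open Classical in
/-- The quartic residue symbol of `β` modulo an odd Gaussian prime `ϖ`: the power of `i` congruent
to `β ^ ((N ϖ - 1) / 4)` modulo `ϖ`, or `0` if there is none, that is, if `ϖ ∣ β`. -/
noncomputable def primeSym (ϖ β : GaussianInt) : GaussianInt :=
  if ∃ k : ℤ, ϖ ∣ β ^ ((ϖ.norm.natAbs - 1) / 4) - iPow k then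
    iPow (Classical.epsilon fun k => ϖ ∣ β ^ ((ϖ.norm.natAbs - 1) / 4) - iPow k) else 0

lemma primeSym_eq_iPow (hϖ : Prime ϖ) (hodd : Odd ϖ.norm) {β : GaussianInt} {k : ℤ}
    (h : ϖ ∣ β ^ ((ϖ.norm.natAbs - 1) / 4) - iPow k) : primeSym ϖ β = iPow k := by
  have hex : ∃ k : ℤ, ϖ ∣ β ^ ((ϖ.norm.natAbs - 1) / 4) - iPow k := ⟨k, h⟩
  rw [primeSym, if_pos hex]
  apply iPow_congr
  apply modEq_of_dvd_iPow_sub_iPow hϖ hodd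
  rw [← sub_sub_sub_cancel_left]
  exact dvd_sub h (Classical.epsilon_spec hex)

lemma dvd_pow_natAbs_norm_sub_one_div_four (hϖ : Prime ϖ) (hodd : Odd ϖ.norm) {β : GaussianInt}
    (h : ϖ ∣ β) : ϖ ∣ β ^ ((ϖ.norm.natAbs - 1) / 4) := by
  refine dvd_pow h fun h0 => hϖ.not_isUnit (Zsqrtd.norm_eq_one_iff.1 ?_)
  have := four_mul_natAbs_norm_sub_one_div hodd
  have := norm_mod_four hodd
  omega

lemma primeSym_eq_zero (hϖ : Prime ϖ) (hodd : Odd ϖ.norm) {β : GaussianInt} (h : ϖ ∣ β) :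
    primeSym ϖ β = 0 := by
  rw [primeSym, if_neg]
  rintro ⟨k, hk⟩
  have hdvd := (dvd_sub_right (dvd_pow_natAbs_norm_sub_one_div_four hϖ hodd h)).1 hk
  exact hϖ.not_isUnit (isUnit_of_dvd_unit hdvd (isUnit_iPow k))

lemma exists_primeSym_eq_iPow (hϖ : Prime ϖ) (hodd : Odd ϖ.norm) {β : GaussianInt}
    (h : ¬ ϖ ∣ β) :
    ∃ k : ℤ, primeSym ϖ β = iPow k ∧ ϖ ∣ β ^ ((ϖ.norm.natAbs - 1) / 4) - iPow k := by
  have := (Ideal.span_singleton_prime hϖ.ne_zero).2 hϖ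
  have hfermat := dvd_pow_natAbs_norm_sub_one_sub_one hϖ hodd h
  rw [← four_mul_natAbs_norm_sub_one_div hodd, mul_comm, pow_mul, ← Ideal.mem_span_singleton,
    ← Ideal.Quotient.eq, map_pow, map_one] at hfermat
  obtain ⟨k, hk⟩ := exists_eq_map_iPow_of_pow_four_eq_one _ hfermat
  rw [Ideal.Quotient.eq, Ideal.mem_span_singleton] at hk
  exact ⟨k, primeSym_eq_iPow hϖ hodd hk, hk⟩

lemma dvd_pow_sub_primeSym (hϖ : Prime ϖ) (hodd : Odd ϖ.norm) (β : GaussianInt) :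
    ϖ ∣ β ^ ((ϖ.norm.natAbs - 1) / 4) - primeSym ϖ β := by
  by_cases h : ϖ ∣ β
  · rw [primeSym_eq_zero hϖ hodd h, sub_zero]
    exact dvd_pow_natAbs_norm_sub_one_div_four hϖ hodd h
  · obtain ⟨k, hk, hd⟩ := exists_primeSym_eq_iPow hϖ hodd h
    rwa [hk]

lemma primeSym_congr {β γ : GaussianInt} (h : ϖ ∣ β - γ) : primeSym ϖ β = primeSym ϖ γ := by
  have hiff (k : ℤ) : ϖ ∣ β ^ ((ϖ.norm.natAbs - 1) / 4) - iPow k ↔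
      ϖ ∣ γ ^ ((ϖ.norm.natAbs - 1) / 4) - iPow k := by
    apply dvd_iff_dvd_of_dvd_sub
    rw [sub_sub_sub_cancel_right]
    exact h.trans (sub_dvd_pow_sub_pow _ _ _)
  classical exact if_congr (exists_congr hiff) (by simp only [hiff]) rfl

lemma primeSym_associated {ϖ' : GaussianInt} (h : Associated ϖ ϖ') (β : GaussianInt) :
    primeSym ϖ β = primeSym ϖ' β := by
  have hN := Zsqrtd.norm_eq_of_associated (by norm_num) h
  have hiff (k : ℤ) : ϖ ∣ β ^ ((ϖ.norm.natAbs - 1) / 4) - iPow k ↔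
      ϖ' ∣ β ^ ((ϖ'.norm.natAbs - 1) / 4) - iPow k := by rw [hN, h.dvd_iff_dvd_left]
  classical exact if_congr (exists_congr hiff) (by simp only [hiff]) rfl

lemma primeSym_one (hϖ : Prime ϖ) (hodd : Odd ϖ.norm) : primeSym ϖ 1 = 1 := by
  rw [← iPow_zero]
  apply primeSym_eq_iPow hϖ hodd
  rw [iPow_zero, one_pow, sub_self]
  exact dvd_zero _

lemma primeSym_mul (hϖ : Prime ϖ) (hodd : Odd ϖ.norm) (β γ : GaussianInt) :
    primeSym ϖ (β * γ) = primeSym ϖ β * primeSym ϖ γ := by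
  by_cases hβ : ϖ ∣ β
  · rw [primeSym_eq_zero hϖ hodd hβ, primeSym_eq_zero hϖ hodd (hβ.mul_right γ), zero_mul]
  by_cases hγ : ϖ ∣ γ
  · rw [primeSym_eq_zero hϖ hodd hγ, primeSym_eq_zero hϖ hodd (hγ.mul_left β), mul_zero]
  obtain ⟨a, ha, ha'⟩ := exists_primeSym_eq_iPow hϖ hodd hβ
  obtain ⟨b, hb, hb'⟩ := exists_primeSym_eq_iPow hϖ hodd hγ
  rw [ha, hb, ← iPow_add]
  apply primeSym_eq_iPow hϖ hodd
  rw [iPow_add, mul_pow]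
  exact dvd_mul_sub_mul ha' hb'

lemma star_dvd_star {a b : GaussianInt} : star a ∣ star b ↔ a ∣ b :=
  map_dvd_iff (starMulAut (R := GaussianInt))

lemma prime_star (hϖ : Prime ϖ) : Prime (star ϖ) :=
  (MulEquiv.prime_iff (starMulAut (R := GaussianInt))).2 hϖ

lemma odd_norm_star {α : GaussianInt} : Odd (star α).norm ↔ Odd α.norm := by
  rw [Zsqrtd.norm_conj]

lemma primeSym_star (hϖ : Prime ϖ) (hodd : Odd ϖ.norm) (β : GaussianInt) :
    primeSym (star ϖ) (star β) = star (primeSym ϖ β) := by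
  have hodd' := odd_norm_star.2 hodd
  by_cases hβ : ϖ ∣ β
  · rw [primeSym_eq_zero hϖ hodd hβ, primeSym_eq_zero (prime_star hϖ) hodd' (star_dvd_star.2 hβ),
      star_zero]
  obtain ⟨a, ha, ha'⟩ := exists_primeSym_eq_iPow hϖ hodd hβ
  rw [ha, star_iPow]
  apply primeSym_eq_iPow (prime_star hϖ) hodd'
  rw [← star_iPow, Zsqrtd.norm_conj, ← star_pow, ← star_sub]
  exact star_dvd_star.2 ha'

lemma sub_one_ediv_four_mul {m n : ℤ} (hm : m % 4 = 1) (hn : n % 4 = 1) :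
    (m * n - 1) / 4 ≡ (m - 1) / 4 + (n - 1) / 4 [ZMOD 4] := by
  obtain ⟨a, rfl⟩ : ∃ a, m = 4 * a + 1 := ⟨m / 4, by omega⟩
  obtain ⟨b, rfl⟩ : ∃ b, n = 4 * b + 1 := ⟨n / 4, by omega⟩
  rw [show (4 * a + 1) * (4 * b + 1) = 4 * (a + b + 4 * (a * b)) + 1 by ring, Int.ModEq]
  omega

lemma primeSym_iPow (hϖ : Prime ϖ) (hodd : Odd ϖ.norm) (k : ℤ) :
    primeSym ϖ (iPow k) = iPow (k * ((ϖ.norm - 1) / 4)) := by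
  apply primeSym_eq_iPow hϖ hodd
  have := norm_mod_four hodd
  have := GaussianInt.norm_nonneg ϖ
  rw [show (ϖ.norm - 1) / 4 = ((ϖ.norm.natAbs - 1) / 4 : ℕ) by omega, iPow_mul, sub_self]
  exact dvd_zero _

/-- The conjugate of `β` being `i ^ j β`, Fermat's little theorem in the form `β ^ l ≡ star β`
makes `β ^ (l - 1)` congruent to `i ^ j`. -/
lemma primeSym_natCast_of_star_eq {l : ℕ} (hl : l.Prime) (h3 : l % 4 = 3) {β : GaussianInt}
    {j : ℤ} (hβ : star β = iPow j * β) (h : ¬ (l : GaussianInt) ∣ β) :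
    primeSym (l : GaussianInt) β = iPow (j * ((l + 1) / 4)) := by
  have := Fact.mk hl
  have hp := GaussianInt.prime_of_nat_prime_of_mod_four_eq_three l h3
  have hpow : (l : GaussianInt) ∣ β ^ (l - 1) - iPow j := by
    refine (hp.dvd_mul.1 ?_).resolve_right h
    rw [sub_mul, ← hβ, ← pow_succ, Nat.sub_add_cancel hl.one_le]
    exact natCast_dvd_pow_sub_star hl h3 β
  have hexp : ((l : GaussianInt).norm.natAbs - 1) / 4 = (l - 1) * ((l + 1) / 4) := by
    obtain ⟨m, rfl⟩ : ∃ m, l = 4 * m + 3 := ⟨l / 4, by omega⟩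
    have hsq : (4 * m + 3) * (4 * m + 3) = 4 * ((4 * m + 2) * (m + 1)) + 1 := by ring
    rw [Zsqrtd.norm_natCast, ← Nat.cast_mul, Int.natAbs_natCast, hsq,
      show (4 * m + 3 + 1) / 4 = m + 1 by omega, show 4 * m + 3 - 1 = 4 * m + 2 by omega]
    omega
  apply primeSym_eq_iPow hp
  · rw [← Int.cast_natCast, odd_norm_intCast, Int.odd_iff]; omega
  · rw [hexp, pow_mul, show ((l : ℤ) + 1) / 4 = ((l + 1) / 4 : ℕ) by omega, iPow_mul]
    exact hpow.trans (sub_dvd_pow_sub_pow _ _ _)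

end PrimeModulus

/-- The quartic residue symbol `χ_α(β)` in the Gaussian integers: the extension of `primeSym` to
all odd moduli `α` that is multiplicative in the modulus. -/
noncomputable def quarticSym (α β : GaussianInt) : GaussianInt :=
  ((factors α).map fun ϖ => primeSym ϖ β).prod

lemma prod_map_primeSym_eq_of_rel {s t : Multiset GaussianInt} (h : Multiset.Rel Associated s t)
    (β : GaussianInt) :
    (s.map fun ϖ => primeSym ϖ β).prod = (t.map fun ϖ => primeSym ϖ β).prod := by
  induction h with
  | zero => rfl
  | cons hab _ ih => simp only [Multiset.map_cons, Multiset.prod_cons, ih, primeSym_associated hab]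

lemma quarticSym_mul_left {α α' : GaussianInt} (h : α ≠ 0) (h' : α' ≠ 0) (β : GaussianInt) :
    quarticSym (α * α') β = quarticSym α β * quarticSym α' β := by
  rw [quarticSym, prod_map_primeSym_eq_of_rel (factors_mul h h'), Multiset.map_add,
    Multiset.prod_add]
  rfl

lemma quarticSym_of_prime {ϖ : GaussianInt} (h : Prime ϖ) (β : GaussianInt) :
    quarticSym ϖ β = primeSym ϖ β := by
  obtain ⟨b, hb, hf⟩ := factors_eq_singleton_of_irreducible h.irreducible
  rw [quarticSym, hf, Multiset.map_singleton, Multiset.prod_singleton, primeSym_associated hb]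

lemma quarticSym_of_isUnit {u : GaussianInt} (h : IsUnit u) (β : GaussianInt) :
    quarticSym u β = 1 := by
  rw [quarticSym, factors_of_isUnit h, Multiset.map_zero, Multiset.prod_zero]

lemma quarticSym_neg_left (α β : GaussianInt) : quarticSym (-α) β = quarticSym α β :=
  prod_map_primeSym_eq_of_rel (factors_rel_of_associated (Associated.neg_left (.refl α))) β

lemma odd_norm_induction {P : ∀ α : GaussianInt, Odd α.norm → Prop}
    (isUnit : ∀ u (_ : IsUnit u) hodd, P u hodd)
    (prime_mul : ∀ ϖ α (_ : Prime ϖ) (hodd : Odd ϖ.norm) (hα : Odd α.norm), P α hα →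
      P (ϖ * α) (odd_norm_mul.2 ⟨hodd, hα⟩))
    {α : GaussianInt} (hα : Odd α.norm) : P α hα := by
  induction α using induction_on_prime with
  | h₁ => exact absurd rfl (ne_zero_of_odd_norm hα)
  | h₂ u hu => exact isUnit u hu hα
  | h₃ α ϖ _ hϖ ih =>
    obtain ⟨hodd, hα'⟩ := odd_norm_mul.1 hα
    exact prime_mul ϖ α hϖ hodd hα' (ih hα')

lemma quarticSym_prime_mul {ϖ α : GaussianInt} (h : Prime ϖ) (hα : Odd α.norm) (β : GaussianInt) :
    quarticSym (ϖ * α) β = primeSym ϖ β * quarticSym α β := by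
  rw [quarticSym_mul_left h.ne_zero (ne_zero_of_odd_norm hα), quarticSym_of_prime h]

section OddModulus

variable {α : GaussianInt} (hα : Odd α.norm)
include hα

lemma quarticSym_mul_right (β γ : GaussianInt) :
    quarticSym α (β * γ) = quarticSym α β * quarticSym α γ := by
  induction hα using odd_norm_induction with
  | isUnit u hu _ => simp only [quarticSym_of_isUnit hu, mul_one]
  | prime_mul ϖ α hϖ hodd hα ih =>
    simp only [quarticSym_prime_mul hϖ hα, ih, primeSym_mul hϖ hodd]
    ring

lemma quarticSym_congr {β γ : GaussianInt} (h : α ∣ β - γ) :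
    quarticSym α β = quarticSym α γ := by
  induction hα using odd_norm_induction with
  | isUnit u hu _ => simp only [quarticSym_of_isUnit hu]
  | prime_mul ϖ α hϖ _ hα ih =>
    simp only [quarticSym_prime_mul hϖ hα, ih (dvd_of_mul_left_dvd h),
      primeSym_congr (dvd_of_mul_right_dvd h)]

lemma quarticSym_star (β : GaussianInt) :
    quarticSym (star α) (star β) = star (quarticSym α β) := by
  induction hα using odd_norm_induction with
  | isUnit u hu _ => rw [quarticSym_of_isUnit hu, quarticSym_of_isUnit hu.star, star_one]
  | prime_mul ϖ α hϖ hodd hα ih =>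
    rw [quarticSym_prime_mul hϖ hα, star_mul', star_mul',
      quarticSym_prime_mul (prime_star hϖ) (odd_norm_star.2 hα), ih, primeSym_star hϖ hodd]

lemma quarticSym_one : quarticSym α 1 = 1 := by
  induction hα using odd_norm_induction with
  | isUnit u hu _ => rw [quarticSym_of_isUnit hu]
  | prime_mul ϖ α hϖ hodd hα ih =>
    rw [quarticSym_prime_mul hϖ hα, ih, primeSym_one hϖ hodd, mul_one]

lemma quarticSym_pow (β : GaussianInt) (n : ℕ) :
    quarticSym α (β ^ n) = quarticSym α β ^ n := by
  induction n with
  | zero => rw [pow_zero, pow_zero, quarticSym_one hα]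
  | succ n ih => rw [pow_succ, pow_succ, quarticSym_mul_right hα, ih]

lemma exists_quarticSym_eq_iPow {β : GaussianInt} (h : IsCoprime α β) :
    ∃ k : ℤ, quarticSym α β = iPow k := by
  induction hα using odd_norm_induction with
  | isUnit u hu _ => exact ⟨0, by rw [quarticSym_of_isUnit hu, iPow_zero]⟩
  | prime_mul ϖ α hϖ hodd hα ih =>
    obtain ⟨hϖβ, hαβ⟩ := IsCoprime.mul_left_iff.1 h
    obtain ⟨k, hk⟩ := ih hαβ
    obtain ⟨m, hm, -⟩ := exists_primeSym_eq_iPow hϖ hodd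
      ((hϖ.irreducible.coprime_iff_not_dvd).1 hϖβ)
    exact ⟨m + k, by rw [quarticSym_prime_mul hϖ hα, hk, hm, iPow_add]⟩

lemma quarticSym_mul_star_quarticSym {β : GaussianInt} (h : IsCoprime α β) :
    quarticSym α β * star (quarticSym α β) = 1 := by
  obtain ⟨k, hk⟩ := exists_quarticSym_eq_iPow hα h
  rw [hk, star_iPow, ← iPow_add, add_neg_cancel, iPow_zero]

lemma quarticSym_mul_star_left (β : GaussianInt) :
    quarticSym (α * star α) β = quarticSym α β * star (quarticSym α (star β)) := by
  rw [quarticSym_mul_left (ne_zero_of_odd_norm hα) (ne_zero_of_odd_norm (odd_norm_star.2 hα)),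
    ← quarticSym_star hα, star_star]

lemma quarticSym_iPow (k : ℤ) :
    quarticSym α (iPow k) = iPow (k * ((α.norm - 1) / 4)) := by
  induction hα using odd_norm_induction with
  | isUnit u hu _ =>
    rw [quarticSym_of_isUnit hu, (Zsqrtd.norm_eq_one_iff' (by norm_num) u).2 hu, sub_self,
      Int.zero_ediv, mul_zero, iPow_zero]
  | prime_mul ϖ α hϖ hodd hα ih =>
    rw [quarticSym_prime_mul hϖ hα, ih, primeSym_iPow hϖ hodd, ← iPow_add, Zsqrtd.norm_mul,
      ← mul_add]
    exact iPow_congr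
      ((sub_one_ediv_four_mul (norm_mod_four hodd) (norm_mod_four hα)).symm.mul_left k)

end OddModulus

/-! ### Rational integers as moduli -/

lemma ne_zero_of_odd {n : ℤ} (hn : Odd n) : n ≠ 0 := by
  rintro rfl
  exact absurd hn (by decide)

lemma mod_four_of_odd {n : ℤ} (h : Odd n) : n % 4 = 1 ∨ n % 4 = 3 := by
  have := Int.odd_iff.1 h
  omega

lemma odd_int_induction {P : ∀ n : ℤ, Odd n → Prop} (one : P 1 odd_one)
    (neg : ∀ n (hn : Odd n), P n hn → P (-n) hn.neg)
    (prime_mul : ∀ (l : ℕ) (n : ℤ) (_ : l.Prime) (hl : Odd (l : ℤ)) (hn : Odd n),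
      P n hn → P (l * n) (hl.mul hn)) {n : ℤ} (hn : Odd n) : P n hn := by
  have natCast (m : ℕ) (hm : Odd (m : ℤ)) : P m hm := by
    induction m using induction_on_primes with
    | zero => exact absurd rfl (ne_zero_of_odd hm)
    | one => simpa using one
    | prime_mul l m hl ih =>
      have hm' := hm
      rw [Nat.cast_mul, Int.odd_mul] at hm'
      simpa using prime_mul l m hl hm'.1 hm'.2 (ih hm'.2)
  obtain ⟨m, rfl | rfl⟩ := Int.eq_nat_or_neg n
  · exact natCast m hn
  · exact neg m (by simpa using hn.neg) (natCast m _)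

lemma quarticSym_natCast_mul {l : ℕ} {n : ℤ} (hl : Odd (l : ℤ)) (hn : Odd n) (β : GaussianInt) :
    quarticSym ((l * n : ℤ) : GaussianInt) β =
      quarticSym (l : GaussianInt) β * quarticSym (n : GaussianInt) β := by
  rw [Int.cast_mul, quarticSym_mul_left (Int.cast_ne_zero.2 (ne_zero_of_odd hl))
    (Int.cast_ne_zero.2 (ne_zero_of_odd hn)), Int.cast_natCast]

lemma quarticSym_natPrime_intCast {l : ℕ} (hl : l.Prime) (hodd : Odd (l : ℤ)) {m : ℤ}
    (h : IsCoprime (l : ℤ) m) : quarticSym (l : GaussianInt) m = 1 := by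
  have hcop : IsCoprime (l : GaussianInt) m := by
    have := h.map (Int.castRingHom GaussianInt)
    rwa [eq_intCast, eq_intCast, Int.cast_natCast] at this
  have := Fact.mk hl
  rcases mod_four_of_odd hodd with h1 | h3
  · obtain ⟨ρ, hρ⟩ := exists_norm_eq_of_mod_four_eq_one hl (by omega)
    rw [← mul_star_of_norm_eq hρ] at hcop ⊢
    rw [← hρ] at hodd
    rw [quarticSym_mul_star_left hodd, star_intCast,
      quarticSym_mul_star_quarticSym hodd hcop.of_mul_left_left]
  · have hp := GaussianInt.prime_of_nat_prime_of_mod_four_eq_three l (by omega)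
    rw [quarticSym_of_prime hp, primeSym_natCast_of_star_eq hl (by omega) (j := 0), zero_mul,
      iPow_zero]
    · rw [star_intCast, iPow_zero, one_mul]
    · exact (hp.irreducible.coprime_iff_not_dvd).1 hcop

lemma quarticSym_intCast_intCast {n m : ℤ} (hn : Odd n) (h : IsCoprime n m) :
    quarticSym (n : GaussianInt) m = 1 := by
  induction hn using odd_int_induction with
  | one => rw [Int.cast_one, quarticSym_of_isUnit isUnit_one]
  | neg n _ ih => rw [Int.cast_neg, quarticSym_neg_left, ih ((IsCoprime.neg_left_iff n m).1 h)]
  | prime_mul l n hl hodd hn ih =>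
    obtain ⟨hlm, hnm⟩ := IsCoprime.mul_left_iff.1 h
    rw [quarticSym_natCast_mul hodd hn, ih hnm, quarticSym_natPrime_intCast hl hodd hlm, mul_one]

/-- The one of `n` and `-n` that is congruent to `1` modulo `4`, for odd `n`; the associate of `n`
by which quartic reciprocity is stated. The value at even `n` is `0`. -/
def primary (n : ℤ) : ℤ := ZMod.χ₄ n * n

lemma primary_of_mod_four_eq_one {n : ℤ} (h : n % 4 = 1) : primary n = n := by
  rw [primary, ZMod.χ₄_int_one_mod_four h, one_mul]

lemma primary_of_mod_four_eq_three {n : ℤ} (h : n % 4 = 3) : primary n = -n := by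
  rw [primary, ZMod.χ₄_int_three_mod_four h, neg_one_mul]

lemma primary_mod_four {n : ℤ} (h : Odd n) : primary n % 4 = 1 := by
  rcases mod_four_of_odd h with h | h
  · rwa [primary_of_mod_four_eq_one h]
  · rw [primary_of_mod_four_eq_three h]; omega

lemma primary_mul (m n : ℤ) : primary (m * n) = primary m * primary n := by
  simp only [primary, Int.cast_mul, map_mul]
  ring

lemma primary_neg (n : ℤ) : primary (-n) = primary n := by
  rw [← neg_one_mul, primary_mul, primary_of_mod_four_eq_three (by norm_num), neg_neg, one_mul]

lemma not_natCast_dvd_of_norm_eq_two {l : ℕ} (hl : Odd (l : ℤ)) (h1 : 1 < l) {β : GaussianInt}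
    (hβ : β.norm = 2) : ¬ (l : GaussianInt) ∣ β := by
  intro h
  have hdvd := norm_dvd_norm h
  rw [Zsqrtd.norm_natCast, hβ] at hdvd
  have hle := Int.le_of_dvd two_pos (dvd_of_mul_left_dvd hdvd)
  have := Int.odd_iff.1 hl
  omega

lemma quarticSym_natPrime_one_add_i {l : ℕ} (hl : l.Prime) (hodd : Odd (l : ℤ)) :
    quarticSym (l : GaussianInt) ⟨1, 1⟩ = iPow ((primary l - 1) / 4) := by
  have hstar : star (⟨1, 1⟩ : GaussianInt) = iPow (-1) * ⟨1, 1⟩ := by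
    rw [iPow_congr (b := 3) (by decide), iPow_three]; decide
  have := Fact.mk hl
  have hnd := not_natCast_dvd_of_norm_eq_two hodd hl.one_lt (β := ⟨1, 1⟩) (by decide)
  rcases mod_four_of_odd hodd with h1 | h3
  · obtain ⟨ρ, hρ⟩ := exists_norm_eq_of_mod_four_eq_one hl (by omega)
    have hρodd : Odd ρ.norm := hρ ▸ hodd
    have hcop : IsCoprime ρ ⟨1, 1⟩ := by
      rw [(prime_of_norm_prime hl hρ).irreducible.coprime_iff_not_dvd]
      intro hd
      have := norm_dvd_norm hd
      rw [hρ, show Zsqrtd.norm (⟨1, 1⟩ : GaussianInt) = 2 by decide] at this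
      have := Int.le_of_dvd two_pos this
      have := hl.one_lt
      omega
    rw [← mul_star_of_norm_eq hρ, quarticSym_mul_star_left hρodd, hstar,
      quarticSym_mul_right hρodd, star_mul', mul_left_comm,
      quarticSym_mul_star_quarticSym hρodd hcop, mul_one, quarticSym_iPow hρodd, star_iPow, hρ,
      primary_of_mod_four_eq_one h1, neg_one_mul, neg_neg]
  · have hp := GaussianInt.prime_of_nat_prime_of_mod_four_eq_three l (by omega)
    rw [quarticSym_of_prime hp, primeSym_natCast_of_star_eq hl (by omega) hstar hnd,
      primary_of_mod_four_eq_three h3]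
    exact congrArg iPow (by omega)

lemma quarticSym_intCast_one_add_i {n : ℤ} (hn : Odd n) :
    quarticSym (n : GaussianInt) ⟨1, 1⟩ = iPow ((primary n - 1) / 4) := by
  induction hn using odd_int_induction with
  | one => rw [Int.cast_one, quarticSym_of_isUnit isUnit_one, primary_of_mod_four_eq_one rfl,
      sub_self, Int.zero_ediv, iPow_zero]
  | neg n hn ih => rw [Int.cast_neg, quarticSym_neg_left, ih, primary_neg]
  | prime_mul l n hl hodd hn ih =>
    rw [quarticSym_natCast_mul hodd hn, ih, quarticSym_natPrime_one_add_i hl hodd, ← iPow_add,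
      primary_mul]
    exact iPow_congr (sub_one_ediv_four_mul (primary_mod_four hodd) (primary_mod_four hn)).symm

/-! ### The quartic character of a prime field and its Jacobi sum -/

section Character

variable {p : ℕ} {ϖ : GaussianInt} (hN : ϖ.norm = p)
include hN

lemma dvd_natCast_of_norm_eq : ϖ ∣ (p : GaussianInt) :=
  ⟨star ϖ, (mul_star_of_norm_eq hN).symm⟩

lemma mod_four_of_norm_eq (hodd : Odd ϖ.norm) : p % 4 = 1 := by
  have := norm_mod_four hodd
  omega

lemma dvd_sub_of_intCast_eq {m n : ℤ} (h : (m : ZMod p) = n) : ϖ ∣ (m : GaussianInt) - n := by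
  have hd : (p : ℤ) ∣ m - n := by
    rw [← ZMod.intCast_zmod_eq_zero_iff_dvd, Int.cast_sub, h, sub_self]
  have := (Zsqrtd.intCast_dvd_intCast (d := -1) _ _).2 hd
  rw [Int.cast_sub, Int.cast_natCast] at this
  exact (dvd_natCast_of_norm_eq hN).trans this

variable [Fact p.Prime]

/-- The quartic residue symbol modulo a Gaussian prime `ϖ` of odd norm `p`, as a multiplicative
character of the residue field `ZMod p`. -/
noncomputable def quarticChar (hodd : Odd ϖ.norm) : MulChar (ZMod p) GaussianInt where
  toFun a := primeSym ϖ ((a.val : ℤ) : GaussianInt)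
  map_one' := by
    have h := dvd_sub_of_intCast_eq hN (m := (1 : ZMod p).val) (n := 1) (by simp)
    rw [primeSym_congr h, Int.cast_one, primeSym_one (prime_of_norm_prime Fact.out hN) hodd]
  map_mul' a b := by
    have h := dvd_sub_of_intCast_eq hN (m := (a * b : ZMod p).val) (n := a.val * b.val) (by simp)
    rw [primeSym_congr h, Int.cast_mul, primeSym_mul (prime_of_norm_prime Fact.out hN) hodd]
  map_nonunit' a ha := by
    rw [isUnit_iff_ne_zero, not_not] at ha
    apply primeSym_eq_zero (prime_of_norm_prime Fact.out hN) hodd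
    rw [ha, ZMod.val_zero, Nat.cast_zero, Int.cast_zero]
    exact dvd_zero ϖ

variable (hodd : Odd ϖ.norm)

lemma quarticChar_intCast (n : ℤ) : quarticChar hN hodd n = primeSym ϖ n :=
  primeSym_congr (dvd_sub_of_intCast_eq hN (by simp))

lemma exists_quarticChar_eq_iPow {a : ZMod p} (ha : a ≠ 0) :
    ∃ k : ℤ, quarticChar hN hodd a = iPow k := by
  have h0 := ((IsUnit.mk0 a ha).map (quarticChar hN hodd)).ne_zero
  obtain ⟨k, hk, -⟩ := exists_primeSym_eq_iPow (prime_of_norm_prime Fact.out hN) hodd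
    fun hd => h0 (primeSym_eq_zero (prime_of_norm_prime Fact.out hN) hodd hd)
  exact ⟨k, hk⟩

lemma quarticChar_pow_four : quarticChar hN hodd ^ 4 = 1 := by
  refine MulChar.ext fun a => ?_
  obtain ⟨k, hk⟩ := exists_quarticChar_eq_iPow hN hodd a.ne_zero
  rw [MulChar.pow_apply_coe, hk, ← iPow_mul, MulChar.one_apply_coe, ← iPow_zero]
  exact iPow_congr (Int.modEq_zero_iff_dvd.2 (Dvd.intro_left k rfl))

lemma quarticChar_inv_apply (a : ZMod p) :
    (quarticChar hN hodd)⁻¹ a = star (quarticChar hN hodd a) := by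
  by_cases ha : a = 0
  · rw [ha, MulChar.map_zero, MulChar.map_zero, star_zero]
  · obtain ⟨k, hk⟩ := exists_quarticChar_eq_iPow hN hodd ha
    refine (isUnit_iPow k).mul_left_cancel ?_
    rw [← hk, ← MulChar.mul_apply, mul_inv_cancel, MulChar.one_apply (IsUnit.mk0 a ha), hk,
      star_iPow, ← iPow_add, add_neg_cancel, iPow_zero]

lemma map_quarticChar {f : GaussianInt →+* ZMod p} (hf : f ϖ = 0) (a : ZMod p) :
    f (quarticChar hN hodd a) = a ^ ((p - 1) / 4) := by
  have hϖ := prime_of_norm_prime Fact.out hN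
  have h := (map_eq_zero_iff_dvd hϖ f hf).2
    (dvd_pow_sub_primeSym hϖ hodd ((a.val : ℤ) : GaussianInt))
  rw [map_sub, map_pow, map_intCast, sub_eq_zero, hN, Int.natAbs_natCast, Int.cast_natCast,
    ZMod.natCast_zmod_val] at h
  exact h.symm

lemma quarticChar_sq_ne_one : quarticChar hN hodd ^ 2 ≠ 1 := by
  intro h
  have h4 := mod_four_of_norm_eq hN hodd
  obtain ⟨-, f, -, hf⟩ := exists_hom_zmod hN
  obtain ⟨a, ha⟩ := FiniteField.exists_nonsquare (F := ZMod p) (by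
    rw [ZMod.ringChar_zmod_n]; omega)
  have ha0 : a ≠ 0 := by rintro rfl; exact ha .zero
  have hval : f ((quarticChar hN hodd ^ 2) a) = 1 := by
    rw [h, MulChar.one_apply (IsUnit.mk0 a ha0), map_one]
  rw [MulChar.pow_apply' _ two_ne_zero, map_pow, map_quarticChar hN hodd hf, ← pow_mul,
    show (p - 1) / 4 * 2 = p / 2 by omega] at hval
  exact ha ((ZMod.euler_criterion p ha0).2 hval)

lemma quarticChar_ne_one : quarticChar hN hodd ≠ 1 := fun h =>
  quarticChar_sq_ne_one hN hodd (by rw [h, one_pow])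

lemma odd_re_jacobiSum_quarticChar :
    Odd (jacobiSum (quarticChar hN hodd) (quarticChar hN hodd)).re := by
  have h4 := mod_four_of_norm_eq hN hodd
  have hroot : IsPrimitiveRoot (⟨0, 1⟩ : GaussianInt) 4 := by
    refine IsPrimitiveRoot.mk_of_lt _ (by norm_num) (by decide) fun l _ _ => ?_
    interval_cases l <;> decide
  obtain ⟨z, -, hz⟩ := exists_jacobiSum_eq_neg_one_add (n := 4) (by norm_num)
    (quarticChar_pow_four hN hodd) (quarticChar_pow_four hN hodd) (by rw [ZMod.card]; omega) hroot
  rw [hz, show ((⟨0, 1⟩ : GaussianInt) - 1) ^ 2 = ⟨0, -2⟩ by decide]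
  simp only [Zsqrtd.re_add, Zsqrtd.re_neg, Zsqrtd.re_one, Zsqrtd.re_mul]
  exact ⟨z.im - 1, by ring⟩

omit hN in
lemma sum_pow_mul_one_sub_pow {k : ℕ} (hk : 2 * k < p - 1) :
    ∑ a : ZMod p, a ^ k * (1 - a) ^ k = 0 := by
  have hexpand (a : ZMod p) : a ^ k * (1 - a) ^ k =
      ∑ m ∈ Finset.range (k + 1), (-1) ^ (m + k) * (k.choose m : ZMod p) * a ^ (k + (k - m)) := by
    rw [sub_pow, Finset.mul_sum]
    refine Finset.sum_congr rfl fun m _ => ?_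
    rw [pow_add, one_pow]; ring
  simp_rw [hexpand]
  rw [Finset.sum_comm]
  refine Finset.sum_eq_zero fun m _ => ?_
  rw [← Finset.mul_sum, FiniteField.sum_pow_lt_card_sub_one, mul_zero]
  rw [ZMod.card]; omega

lemma dvd_jacobiSum_quarticChar :
    ϖ ∣ jacobiSum (quarticChar hN hodd) (quarticChar hN hodd) := by
  obtain ⟨-, f, -, hf⟩ := exists_hom_zmod hN
  have hp := (Fact.out : p.Prime).one_lt
  rw [← map_eq_zero_iff_dvd (prime_of_norm_prime Fact.out hN) f hf, jacobiSum, map_sum]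
  simp only [map_mul, map_quarticChar hN hodd hf]
  exact sum_pow_mul_one_sub_pow (by omega)

lemma norm_jacobiSum_quarticChar :
    (jacobiSum (quarticChar hN hodd) (quarticChar hN hodd)).norm = p := by
  set χ := quarticChar hN hodd
  have hinj : Function.Injective GaussianInt.toComplex := GaussianInt.toComplex_injective
  have hne := (MulChar.ringHomComp_ne_one_iff hinj).2 (quarticChar_ne_one hN hodd)
  have hne2 := (MulChar.ringHomComp_ne_one_iff hinj).2 (quarticChar_sq_ne_one hN hodd)
  rw [pow_two, MulChar.ringHomComp_mul] at hne2
  have hchar : ringChar ℂ ≠ ringChar (ZMod p) := by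
    rw [ZMod.ringChar_zmod_n, ringChar.eq_zero]
    exact (Fact.out : p.Prime).ne_zero.symm
  have hstar : jacobiSum χ⁻¹ χ⁻¹ = star (jacobiSum χ χ) := by
    simp only [jacobiSum, star_sum, star_mul', quarticChar_inv_apply, χ]
  have h := jacobiSum_mul_jacobiSum_inv hchar hne hne hne2
  rw [MulChar.ringHomComp_inv, jacobiSum_ringHomComp, jacobiSum_ringHomComp, ← map_mul,
    ZMod.card, hstar, ← Zsqrtd.norm_eq_mul_conj, map_intCast] at h
  exact_mod_cast h

lemma jacobiSum_quarticChar_sq (him : Even ϖ.im) :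
    jacobiSum (quarticChar hN hodd) (quarticChar hN hodd) ^ 2 = ϖ ^ 2 := by
  have hre := odd_re_jacobiSum_quarticChar hN hodd
  have hassoc : Associated ϖ (jacobiSum (quarticChar hN hodd) (quarticChar hN hodd)) := by
    refine associated_of_dvd_of_norm_eq (fun h0 => ?_) (dvd_jacobiSum_quarticChar hN hodd) ?_
    · rw [h0] at hre; exact absurd hre (by decide)
    · rw [hN, norm_jacobiSum_quarticChar hN hodd]
  obtain ⟨u, hu⟩ := hassoc
  obtain ⟨k, hk⟩ := exists_eq_iPow_of_isUnit u.isUnit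
  rw [← hu, hk] at hre ⊢
  rw [Int.odd_iff] at hre
  rw [Int.even_iff] at him
  rcases iPow_cases k with ⟨-, h⟩ | ⟨-, h⟩ | ⟨-, h⟩ | ⟨-, h⟩ <;> rw [h] at hre ⊢
  · rw [mul_one]
  · simp only [Zsqrtd.re_mul] at hre
    omega
  · rw [mul_neg_one, neg_sq]
  · simp only [Zsqrtd.re_mul] at hre
    omega

end Character

/-! ### Gauss sums of quartic characters -/

section GaussSum

variable {F K : Type*} [Field F] [Fintype F] [CommRing K] {χ : MulChar F K} {ψ : AddChar F K}

lemma gaussSum_pow_four [IsDomain K] (h4 : χ ^ 4 = 1) (h2 : χ ^ 2 ≠ 1) (hψ : ψ.IsPrimitive) :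
    gaussSum χ ψ ^ 4 = Fintype.card F * jacobiSum χ χ ^ 2 := by
  have hquad : (χ ^ 2).IsQuadratic :=
    MulChar.isQuadratic_iff_sq_eq_one.2 (by rw [← pow_mul, h4])
  have hneg : (χ ^ 2) (-1) = 1 := by
    rw [MulChar.pow_apply' _ two_ne_zero, ← map_pow, neg_one_sq, map_one]
  have hsq := gaussSum_sq h2 hquad hψ
  rw [hneg, one_mul, pow_two χ] at hsq
  have hjac := jacobiSum_mul_nontrivial (pow_two χ ▸ h2) ψ
  rw [← hsq, ← mul_pow, hjac, ← pow_two, ← pow_mul]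

variable {l : ℕ} [Fact l.Prime] [CharP K l]

lemma map_natCast_pow_mul_gaussSum_pow (hl : (l : F) ≠ 0) :
    χ l ^ l * gaussSum χ ψ ^ l = gaussSum (χ ^ l) ψ := by
  have h := gaussSum_mulShift (χ ^ l) ψ (Units.mk0 (l : F) hl)
  rwa [Units.val_mk0, MulChar.pow_apply' _ (Fact.out : l.Prime).ne_zero, ← AddChar.pow_mulShift,
    ← gaussSum_frob l] at h

lemma map_natCast_mul_pow_eq_one [IsDomain K] (hl : (l : F) ≠ 0) (hcard : (Fintype.card F : K) ≠ 0)
    (h4 : χ ^ 4 = 1) (h2 : χ ^ 2 ≠ 1) (hψ : ψ.IsPrimitive) {s : ℕ} (hs : l = 4 * s + 1) :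
    χ l * (Fintype.card F * jacobiSum χ χ ^ 2) ^ s = 1 := by
  have hχl : χ ^ l = χ := by rw [hs, pow_succ, pow_mul, h4, one_pow, one_mul]
  have hG0 : gaussSum χ ψ ≠ 0 :=
    gaussSum_ne_zero_of_nontrivial hcard (fun h => h2 (by rw [h, one_pow])) hψ
  have hfrob := map_natCast_pow_mul_gaussSum_pow (χ := χ) (ψ := ψ) hl
  rw [← MulChar.pow_apply' _ (Fact.out : l.Prime).ne_zero, hχl] at hfrob
  refine mul_right_cancel₀ hG0 ?_
  rw [← gaussSum_pow_four h4 h2 hψ, ← pow_mul, mul_assoc, ← pow_succ, ← hs, hfrob, one_mul]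

lemma pow_eq_map_neg_natCast_mul [IsDomain K] (hl : (l : F) ≠ 0) (h4 : χ ^ 4 = 1) (h2 : χ ^ 2 ≠ 1)
    (hψ : ψ.IsPrimitive) {s : ℕ} (hs : l = 4 * s + 3) :
    (Fintype.card F * jacobiSum χ χ ^ 2) ^ (s + 1) = χ (-l) * Fintype.card F := by
  have hχl : χ ^ l = χ⁻¹ := by
    rw [eq_inv_iff_mul_eq_one, ← pow_succ, hs, show 4 * s + 3 + 1 = 4 * (s + 1) by ring, pow_mul,
      h4, one_pow]
  have hinv : χ l * χ⁻¹ l = 1 := by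
    rw [← MulChar.mul_apply, mul_inv_cancel, MulChar.one_apply (IsUnit.mk0 _ hl)]
  have hneg : χ⁻¹ (-1) = χ (-1) := by rw [MulChar.inv_apply', inv_neg_one]
  have hfrob := map_natCast_pow_mul_gaussSum_pow (χ := χ) (ψ := ψ) hl
  rw [← MulChar.pow_apply' _ (Fact.out : l.Prime).ne_zero, hχl] at hfrob
  have hshift := mul_gaussSum_inv_eq_gaussSum χ⁻¹ ψ
  rw [hneg] at hshift
  have hne : χ ≠ 1 := fun h => h2 (by rw [h, one_pow])
  have hcard := gaussSum_mul_gaussSum_eq_card hne hψ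
  calc (Fintype.card F * jacobiSum χ χ ^ 2) ^ (s + 1)
      = gaussSum χ ψ ^ l * gaussSum χ ψ := by
        rw [← gaussSum_pow_four h4 h2 hψ, ← pow_mul, ← pow_succ, hs]; ring
    _ = χ l * (χ⁻¹ l * gaussSum χ ψ ^ l) * gaussSum χ ψ := by rw [← mul_assoc, hinv, one_mul]
    _ = χ (-1) * χ l * (gaussSum χ ψ * gaussSum χ⁻¹ ψ⁻¹) := by rw [hfrob, ← hshift]; ring
    _ = χ (-l) * Fintype.card F := by rw [hcard, ← map_mul, neg_one_mul]

end GaussSum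

/-! ### Reciprocity between a Gaussian prime and a rational prime -/

lemma exists_field_addChar {ρ : GaussianInt} (hρ : Prime ρ) {l p : ℕ} [Fact l.Prime]
    [Fact p.Prime] (hd : ρ ∣ (l : GaussianInt)) (hlp : l ≠ p) :
    ∃ (K : Type) (_ : Field K) (_ : CharP K l) (f : GaussianInt →+* K) (ψ : AddChar (ZMod p) K),
      f ρ = 0 ∧ ψ.IsPrimitive := by
  have hmax : (Ideal.span {ρ}).IsMaximal :=
    PrincipalIdealRing.isMaximal_of_irreducible hρ.irreducible
  let k := GaussianInt ⧸ Ideal.span {ρ}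
  let _ : Field k := Ideal.Quotient.field _
  have hl : (l : k) = 0 := by
    rw [← map_natCast (Ideal.Quotient.mk (Ideal.span {ρ})), Ideal.Quotient.eq_zero_iff_dvd]
    exact hd
  have hchar : ringChar k = l := CharP.ringChar_of_prime_eq_zero Fact.out hl
  have : CharP k l := ringChar.of_eq hchar
  let ψ := AddChar.FiniteField.primitiveChar (ZMod p) k (by rwa [hchar, ZMod.ringChar_zmod_n])
  refine ⟨CyclotomicField ψ.n k, inferInstance,
    charP_of_injective_algebraMap (algebraMap k (CyclotomicField ψ.n k)).injective l,
    (algebraMap k (CyclotomicField ψ.n k)).comp (Ideal.Quotient.mk _), ψ.char, ?_, ψ.prim⟩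
  rw [RingHom.comp_apply, (Ideal.Quotient.eq_zero_iff_dvd _ _).2 dvd_rfl, map_zero]

lemma map_pow_eq_map_primeSym {K : Type*} [CommRing K] {ρ : GaussianInt} (hρ : Prime ρ)
    (hodd : Odd ρ.norm) {f : GaussianInt →+* K} (h0 : f ρ = 0) (β : GaussianInt) :
    f β ^ ((ρ.norm.natAbs - 1) / 4) = f (primeSym ρ β) := by
  rw [← map_pow, ← sub_eq_zero, ← map_sub, ← zero_dvd_iff, ← h0]
  exact map_dvd f (dvd_pow_sub_primeSym hρ hodd β)

lemma not_dvd_of_dvd_natCast {ρ z : GaussianInt} (hρ : Prime ρ) {l n : ℕ}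
    (hd : ρ ∣ (l : GaussianInt)) (hcop : l.Coprime n) (hz : z.norm = n) : ¬ ρ ∣ z := by
  intro h
  have hn : ρ ∣ (n : GaussianInt) := h.trans (dvd_natCast_of_norm_eq hz)
  exact hρ.not_isUnit ((Nat.Coprime.cast (R := GaussianInt) hcop).isUnit_of_dvd' hd hn)

section Reciprocity

variable {p : ℕ} [Fact p.Prime] {ϖ : GaussianInt} (hN : ϖ.norm = p) (hodd : Odd ϖ.norm)

section ResidueField

variable {K : Type*} [Field K] {f : GaussianInt →+* K}

lemma ringHomComp_quarticChar_pow_four : (quarticChar hN hodd).ringHomComp f ^ 4 = 1 := by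
  rw [MulChar.ringHomComp_pow, quarticChar_pow_four, MulChar.ringHomComp_one]

lemma ringHomComp_quarticChar_sq_ne_one (h2 : (2 : K) ≠ 0) :
    (quarticChar hN hodd).ringHomComp f ^ 2 ≠ 1 := by
  intro h
  refine quarticChar_sq_ne_one hN hodd (MulChar.ext fun a => ?_)
  have ha := DFunLike.congr_fun h (a : ZMod p)
  obtain ⟨k, hk⟩ := exists_quarticChar_eq_iPow hN hodd a.ne_zero
  rw [MulChar.pow_apply_coe, MulChar.ringHomComp_apply, hk, ← map_pow, ← iPow_mul,
    MulChar.one_apply_coe, map_iPow_eq_one_iff f h2] at ha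
  rw [MulChar.pow_apply_coe, hk, ← iPow_mul, iPow_congr ha, iPow_zero, MulChar.one_apply_coe]

variable {l : ℕ} [Fact l.Prime] [CharP K l] {ψ : AddChar (ZMod p) K} {s : ℕ}

lemma card_mul_jacobiSum_ringHomComp_sq (him : Even ϖ.im) :
    (Fintype.card (ZMod p) : K) * jacobiSum ((quarticChar hN hodd).ringHomComp f)
      ((quarticChar hN hodd).ringHomComp f) ^ 2 = f (ϖ ^ 3 * star ϖ) := by
  rw [jacobiSum_ringHomComp, ← map_pow, jacobiSum_quarticChar_sq hN hodd him, ZMod.card,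
    ← map_natCast f, ← mul_star_of_norm_eq hN, ← map_mul]
  ring_nf

include hN hodd in
lemma map_primeSym_mul_pow_eq_one (hlp : l ≠ p) (h2 : (2 : K) ≠ 0) (hψ : ψ.IsPrimitive)
    (him : Even ϖ.im) (hs : l = 4 * s + 1) :
    f (primeSym ϖ (l : ℤ)) * f (ϖ ^ 3 * star ϖ) ^ s = 1 := by
  have hl : (l : ZMod p) ≠ 0 := CharP.cast_ne_zero_of_ne_of_prime _ Fact.out hlp.symm
  have hcard : (Fintype.card (ZMod p) : K) ≠ 0 := by
    rw [ZMod.card]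
    exact CharP.cast_ne_zero_of_ne_of_prime _ Fact.out hlp
  have h := map_natCast_mul_pow_eq_one hl hcard (ringHomComp_quarticChar_pow_four hN hodd (f := f))
    (ringHomComp_quarticChar_sq_ne_one hN hodd h2) hψ hs
  rwa [card_mul_jacobiSum_ringHomComp_sq hN hodd him, MulChar.ringHomComp_apply,
    ← Int.cast_natCast, quarticChar_intCast] at h

include hN hodd in
lemma pow_eq_map_primeSym_mul (hlp : l ≠ p) (h2 : (2 : K) ≠ 0) (hψ : ψ.IsPrimitive)
    (him : Even ϖ.im) (hs : l = 4 * s + 3) :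
    f (ϖ ^ 3 * star ϖ) ^ (s + 1) = f (primeSym ϖ (-l : ℤ)) * f (ϖ * star ϖ) := by
  have hl : (l : ZMod p) ≠ 0 := CharP.cast_ne_zero_of_ne_of_prime _ Fact.out hlp.symm
  have h := pow_eq_map_neg_natCast_mul hl (ringHomComp_quarticChar_pow_four hN hodd (f := f))
    (ringHomComp_quarticChar_sq_ne_one hN hodd h2) hψ hs
  rwa [card_mul_jacobiSum_ringHomComp_sq hN hodd him, MulChar.ringHomComp_apply,
    ← Int.cast_natCast, ← Int.cast_neg, quarticChar_intCast, ZMod.card, ← map_natCast f p,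
    ← mul_star_of_norm_eq hN] at h

end ResidueField

variable {l : ℕ} [Fact l.Prime]

include hN hodd

omit [Fact l.Prime] in
lemma exists_primeSym_intCast_eq_iPow {n : ℤ} (hn : (n : ZMod p) ≠ 0) :
    ∃ k : ℤ, primeSym ϖ n = iPow k := by
  rw [← quarticChar_intCast hN hodd]
  exact exists_quarticChar_eq_iPow hN hodd hn

lemma primeSym_natCast_of_mod_four_eq_one (hlp : l ≠ p) (hl : l % 4 = 1) (him : Even ϖ.im) :
    primeSym ϖ (l : ℤ) = quarticSym (l : GaussianInt) ϖ := by
  obtain ⟨ρ, hNρ⟩ := exists_norm_eq_of_mod_four_eq_one Fact.out hl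
  have hρ := prime_of_norm_prime Fact.out hNρ
  have hρodd : Odd ρ.norm := by rw [hNρ, Int.odd_iff]; omega
  have hdl := dvd_natCast_of_norm_eq hNρ
  have hcop := (Nat.coprime_primes Fact.out Fact.out).2 hlp
  obtain ⟨K, _, _, f, ψ, hf, hψ⟩ := exists_field_addChar hρ hdl hlp
  have h2 : (2 : K) ≠ 0 := CharP.cast_ne_zero_of_ne_of_prime K Nat.prime_two (by omega : l ≠ 2)
  obtain ⟨k, hk, -⟩ := exists_primeSym_eq_iPow hρ hρodd (not_dvd_of_dvd_natCast hρ hdl hcop hN)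
  obtain ⟨m, hm, -⟩ := exists_primeSym_eq_iPow hρ hρodd
    (not_dvd_of_dvd_natCast hρ hdl hcop ((Zsqrtd.norm_conj ϖ).trans hN))
  obtain ⟨n, hn⟩ := exists_primeSym_intCast_eq_iPow hN hodd (n := l) (by
    rw [Int.cast_natCast]; exact CharP.cast_ne_zero_of_ne_of_prime _ Fact.out hlp.symm)
  have h := map_primeSym_mul_pow_eq_one hN hodd hlp h2 hψ him (f := f)
    (s := (ρ.norm.natAbs - 1) / 4) (by rw [hNρ, Int.natAbs_natCast]; omega)
  rw [map_pow_eq_map_primeSym hρ hρodd hf, ← map_mul, pow_succ, pow_two, primeSym_mul hρ hρodd,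
    primeSym_mul hρ hρodd, primeSym_mul hρ hρodd, hk, hm, hn, ← iPow_add, ← iPow_add, ← iPow_add,
    ← iPow_add, map_iPow_eq_one_iff f h2, Int.ModEq] at h
  rw [← mul_star_of_norm_eq hNρ, quarticSym_mul_star_left hρodd, quarticSym_of_prime hρ,
    quarticSym_of_prime hρ, hn, hk, hm, star_iPow, ← iPow_add, iPow_inj, Int.ModEq]
  omega

lemma primeSym_neg_natCast_of_mod_four_eq_three (hlp : l ≠ p) (hl : l % 4 = 3)
    (him : Even ϖ.im) : primeSym ϖ (-l : ℤ) = quarticSym (l : GaussianInt) ϖ := by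
  have hρ := GaussianInt.prime_of_nat_prime_of_mod_four_eq_three l hl
  have hρodd : Odd (l : GaussianInt).norm := by
    rw [← Int.cast_natCast, odd_norm_intCast, Int.odd_iff]; omega
  obtain ⟨K, _, _, f, ψ, hf, hψ⟩ := exists_field_addChar hρ dvd_rfl hlp
  have h2 : (2 : K) ≠ 0 := CharP.cast_ne_zero_of_ne_of_prime K Nat.prime_two (by omega : l ≠ 2)
  have hcop := (Nat.coprime_primes Fact.out Fact.out).2 hlp
  have hnd := not_dvd_of_dvd_natCast hρ dvd_rfl hcop hN
  obtain ⟨k, hk, -⟩ := exists_primeSym_eq_iPow hρ hρodd hnd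
  obtain ⟨n, hn⟩ := exists_primeSym_intCast_eq_iPow hN hodd (n := -l) (by
    rw [Int.cast_neg, Int.cast_natCast, neg_ne_zero]
    exact CharP.cast_ne_zero_of_ne_of_prime _ Fact.out hlp.symm)
  have hw : f ϖ ≠ 0 := by rwa [Ne, map_eq_zero_iff_dvd hρ f hf]
  obtain ⟨s, hs⟩ : ∃ s, l = 4 * s + 3 := ⟨l / 4, by omega⟩
  have hexp : ((l : GaussianInt).norm.natAbs - 1) / 4 = (4 * s + 2) * (s + 1) := by
    rw [Zsqrtd.norm_natCast, Int.natAbs_mul, Int.natAbs_natCast, hs,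
      show (4 * s + 3) * (4 * s + 3) - 1 = 4 * ((4 * s + 2) * (s + 1)) by ring_nf; omega,
      Nat.mul_div_cancel_left _ (by norm_num)]
  have hsym := map_pow_eq_map_primeSym hρ hρodd hf ϖ
  have h := pow_eq_map_primeSym_mul hN hodd hlp h2 hψ him hs (f := f)
  rw [map_mul, map_pow, map_mul, ← map_pow_eq_map_star Fact.out hl f ϖ] at h
  have hcancel : f (primeSym ϖ (-l : ℤ)) = f (primeSym l ϖ) := by
    refine mul_right_cancel₀ (mul_ne_zero hw (pow_ne_zero l hw)) ?_
    rw [← h, ← hsym, hexp, hs]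
    ring
  rw [hn, hk, map_iPow_inj f h2] at hcancel
  rw [quarticSym_of_prime hρ, hn, hk, iPow_congr hcancel]

end Reciprocity

/-! ### Quartic reciprocity with rational integers -/

section Parity

variable {z w : GaussianInt} {k : ℤ}

lemma odd_norm_iff : Odd z.norm ↔ (Odd z.re ↔ Even z.im) := by
  rw [Zsqrtd.norm_def, mul_assoc, neg_one_mul, sub_neg_eq_add, Int.odd_add, Int.odd_mul,
    Int.even_mul, and_self, or_self]

lemma even_im_mul_iff (hz : Odd z.norm) (him : Even z.im) : Even (z * w).im ↔ Even w.im := by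
  have hre := (odd_norm_iff.1 hz).2 him
  rw [Zsqrtd.im_mul, Int.even_add, Int.even_mul, Int.even_mul]
  simp only [him, Int.not_even_iff_odd.2 hre, false_or, true_or, iff_true]

lemma iPow_eq_one_or_eq_neg_one (h : Even (iPow k).im) : iPow k = 1 ∨ iPow k = -1 := by
  rcases iPow_cases k with ⟨-, hk⟩ | ⟨-, hk⟩ | ⟨-, hk⟩ | ⟨-, hk⟩
  · exact .inl hk
  · rw [hk] at h; exact absurd h (by decide)
  · exact .inr hk
  · rw [hk] at h; exact absurd h (by decide)

lemma exists_even_im_iPow_mul (hz : Odd z.norm) : ∃ k : ℤ, Even (iPow k * z).im := by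
  by_cases him : Even z.im
  · exact ⟨0, by rwa [iPow_zero, one_mul]⟩
  · have hre : Even z.re := by rwa [← Int.not_odd_iff_even, odd_norm_iff.1 hz]
    refine ⟨1, ?_⟩
    rwa [iPow_one, Zsqrtd.im_mul, zero_mul, one_mul, zero_add]

lemma even_im_induction {P : GaussianInt → Prop} (one : P 1) (neg : ∀ α, P α → P (-α))
    (prime_mul : ∀ ϖ α, Prime ϖ → Odd ϖ.norm → Even ϖ.im → Odd α.norm → P α → P (ϖ * α))
    {α : GaussianInt} (hα : Odd α.norm) (him : Even α.im) : P α := by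
  suffices h : ∀ k : ℤ, Even (iPow k * α).im → P (iPow k * α) by
    simpa only [iPow_zero, one_mul, him, forall_const] using h 0
  clear him
  induction hα using odd_norm_induction with
  | isUnit u hu _ =>
    intro k hk
    obtain ⟨j, rfl⟩ := exists_eq_iPow_of_isUnit hu
    rw [← iPow_add] at hk ⊢
    rcases iPow_eq_one_or_eq_neg_one hk with h | h <;> rw [h]
    exacts [one, neg _ one]
  | prime_mul ϖ α hϖ hodd hα ih =>
    intro k hk
    obtain ⟨m, hm⟩ := exists_even_im_iPow_mul hodd
    have hass : Associated ϖ (iPow m * ϖ) := ⟨(isUnit_iPow m).unit, mul_comm _ _⟩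
    have hodd' : Odd (iPow m * ϖ).norm := by
      rwa [← Zsqrtd.norm_eq_of_associated (by norm_num) hass]
    have hsplit : iPow k * (ϖ * α) = iPow m * ϖ * (iPow (k - m) * α) := by
      rw [← add_sub_cancel m k, iPow_add, add_sub_cancel]; ring
    rw [hsplit, even_im_mul_iff hodd' hm] at hk
    rw [hsplit]
    refine prime_mul _ _ (hass.prime hϖ) hodd' hm ?_ (ih _ hk)
    rwa [odd_norm_mul, (Zsqrtd.norm_eq_one_iff' (by norm_num) _).2 (isUnit_iPow _),
      and_iff_right odd_one]

end Parity

lemma quarticSym_eq_zero {α β ϖ : GaussianInt} (hα : Odd α.norm) (hϖ : Prime ϖ) (h : ϖ ∣ α)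
    (h' : ϖ ∣ β) : quarticSym α β = 0 := by
  obtain ⟨γ, rfl⟩ := h
  obtain ⟨hodd, hγ⟩ := odd_norm_mul.1 hα
  rw [quarticSym_prime_mul hϖ hγ, primeSym_eq_zero hϖ hodd h', zero_mul]

lemma dvd_intCast_primary {ϖ : GaussianInt} {n : ℤ} (hn : Odd n) (h : ϖ ∣ (n : GaussianInt)) :
    ϖ ∣ (primary n : GaussianInt) := by
  rcases mod_four_of_odd hn with h4 | h4
  · rwa [primary_of_mod_four_eq_one h4]
  · rwa [primary_of_mod_four_eq_three h4, Int.cast_neg, dvd_neg]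

section Split

variable {p : ℕ} [Fact p.Prime] {ϖ : GaussianInt} (hN : ϖ.norm = p) (hodd : Odd ϖ.norm)
  (him : Even ϖ.im)
include hN hodd him

lemma primeSym_primary_natPrime {l : ℕ} (hl : l.Prime) (hl2 : Odd (l : ℤ)) :
    primeSym ϖ (primary l) = quarticSym (l : GaussianInt) ϖ := by
  have := Fact.mk hl
  have hϖ := prime_of_norm_prime Fact.out hN
  by_cases hlp : l = p
  · have hd : ϖ ∣ (l : GaussianInt) := hlp ▸ dvd_natCast_of_norm_eq hN
    have hlodd : Odd (l : GaussianInt).norm := by rwa [← Int.cast_natCast, odd_norm_intCast]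
    rw [quarticSym_eq_zero hlodd hϖ hd dvd_rfl, primeSym_eq_zero hϖ hodd]
    exact dvd_intCast_primary hl2 (by rwa [Int.cast_natCast])
  · rcases mod_four_of_odd hl2 with h4 | h4
    · rw [primary_of_mod_four_eq_one h4]
      exact primeSym_natCast_of_mod_four_eq_one hN hodd hlp (by omega) him
    · rw [primary_of_mod_four_eq_three h4]
      exact primeSym_neg_natCast_of_mod_four_eq_three hN hodd hlp (by omega) him

lemma primeSym_primary_of_norm_eq {n : ℤ} (hn : Odd n) :
    primeSym ϖ (primary n) = quarticSym (n : GaussianInt) ϖ := by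
  have hϖ := prime_of_norm_prime Fact.out hN
  induction hn using odd_int_induction with
  | one => rw [Int.cast_one, quarticSym_of_isUnit isUnit_one, primary_of_mod_four_eq_one rfl,
      Int.cast_one, primeSym_one hϖ hodd]
  | neg n hn ih => rw [primary_neg, ih, Int.cast_neg, quarticSym_neg_left]
  | prime_mul l n hl hl2 hn ih =>
    rw [quarticSym_natCast_mul hl2 hn, primary_mul, Int.cast_mul, primeSym_mul hϖ hodd, ih,
      primeSym_primary_natPrime hN hodd him hl hl2]

end Split

lemma isCoprime_primary {m n : ℤ} (hn : Odd n) (h : IsCoprime m n) : IsCoprime m (primary n) := by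
  rcases mod_four_of_odd hn with h4 | h4
  · rwa [primary_of_mod_four_eq_one h4]
  · rw [primary_of_mod_four_eq_three h4]; exact h.neg_right

lemma quarticSym_intCast_neg_one {n : ℤ} (hn : Odd n) : quarticSym (n : GaussianInt) (-1) = 1 := by
  have h := quarticSym_intCast_intCast hn (m := -1) isCoprime_one_right.neg_right
  rwa [Int.cast_neg, Int.cast_one] at h

lemma primeSym_primary_of_associated_natCast {ϖ : GaussianInt} {r : ℕ} (hr : r.Prime)
    (h3 : r % 4 = 3) (ha : Associated ϖ (r : GaussianInt)) (him : Even ϖ.im) {n : ℤ} (hn : Odd n) :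
    primeSym ϖ (primary n) = quarticSym (n : GaussianInt) ϖ := by
  have := Fact.mk hr
  have hrp := GaussianInt.prime_of_nat_prime_of_mod_four_eq_three r h3
  have hrodd : Odd (r : ℤ) := by rw [Int.odd_iff]; omega
  have hrn : Odd (r : GaussianInt).norm := by rwa [← Int.cast_natCast, odd_norm_intCast]
  have hnodd := odd_norm_intCast.2 hn
  rw [primeSym_associated ha, ← quarticSym_of_prime hrp]
  by_cases hd : (r : ℤ) ∣ n
  · have hd' : (r : GaussianInt) ∣ n := by
      rw [← Int.cast_natCast]; exact (Zsqrtd.intCast_dvd_intCast _ _).2 hd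
    rw [quarticSym_eq_zero hrn hrp dvd_rfl (dvd_intCast_primary hn hd'),
      quarticSym_eq_zero hnodd hrp hd' ha.symm.dvd]
  · have hcop : IsCoprime (r : ℤ) n := (Nat.prime_iff_prime_int.1 hr).coprime_iff_not_dvd.2 hd
    obtain ⟨u, hu⟩ := ha.symm
    obtain ⟨k, hk⟩ := exists_eq_iPow_of_isUnit u.isUnit
    rw [← hu, hk, even_im_mul_iff hrn (by rw [Zsqrtd.im_natCast]; exact .zero)] at him
    rw [← hu, hk, ← Int.cast_natCast, quarticSym_intCast_intCast hrodd (isCoprime_primary hn hcop),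
      quarticSym_mul_right hnodd, quarticSym_intCast_intCast hn hcop.symm, one_mul]
    rcases iPow_eq_one_or_eq_neg_one him with h | h <;> rw [h]
    · exact (quarticSym_one hnodd).symm
    · exact (quarticSym_intCast_neg_one hn).symm

lemma quarticSym_reciprocity {α : GaussianInt} (hα : Odd α.norm) (him : Even α.im) {n : ℤ}
    (hn : Odd n) : quarticSym α (primary n) = quarticSym (n : GaussianInt) α := by
  have hnodd := odd_norm_intCast.2 hn
  refine even_im_induction (P := fun α => quarticSym α (primary n) = quarticSym (n : GaussianInt) α)
    ?_ (fun α ih => ?_) (fun ϖ α hϖ hodd him hα ih => ?_) hα him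
  · rw [quarticSym_of_isUnit isUnit_one, quarticSym_one hnodd]
  · rw [quarticSym_neg_left, ih, ← neg_one_mul α, quarticSym_mul_right hnodd,
      quarticSym_intCast_neg_one hn, one_mul]
  · rw [quarticSym_prime_mul hϖ hα, ih, quarticSym_mul_right hnodd]
    congr 1
    rcases norm_prime_or_associated_natCast hϖ hodd with ⟨p, hp, -, hN⟩ | ⟨r, hr, h3, ha⟩
    · have := Fact.mk hp
      exact primeSym_primary_of_norm_eq hN hodd him hn
    · exact primeSym_primary_of_associated_natCast hr h3 ha him hn

/-! ### The symbols of `2` and `1 - i` -/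

lemma iPow_inj_zmod {a b : ℤ} : iPow a = iPow b ↔ (a : ZMod 4) = b := by
  rw [iPow_inj]
  exact (ZMod.intCast_eq_intCast_iff a b 4).symm

lemma norm_mk (a b : ℤ) : (⟨a, b⟩ : GaussianInt).norm = a ^ 2 + b ^ 2 := by
  rw [Zsqrtd.norm_def]
  ring

lemma odd_norm_mk (A B : ℤ) : Odd (⟨2 * A + 1, 2 * B⟩ : GaussianInt).norm :=
  odd_norm_iff.2 (iff_of_true (odd_two_mul_add_one A) (even_two_mul B))

lemma quarticSym_mk_iPow (A B k : ℤ) :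
    quarticSym ⟨2 * A + 1, 2 * B⟩ (iPow k) = iPow (k * (A ^ 2 + A + B ^ 2)) := by
  rw [quarticSym_iPow (odd_norm_mk A B), norm_mk,
    show (2 * A + 1) ^ 2 + (2 * B) ^ 2 - 1 = 4 * (A ^ 2 + A + B ^ 2) by ring,
    Int.mul_ediv_cancel_left _ four_ne_zero]

lemma quarticSym_intCast_iPow (A k : ℤ) :
    quarticSym ((2 * A + 1 : ℤ) : GaussianInt) (iPow k) = iPow (k * (A ^ 2 + A)) := by
  have h := quarticSym_mk_iPow A 0 k
  rwa [mul_zero, zero_pow two_ne_zero, add_zero, ← Zsqrtd.intCast_val] at h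

lemma quarticSym_mk_intCast (A B : ℤ) {m : ℤ} (hm : Odd m) :
    quarticSym ⟨2 * A + 1, 2 * B⟩ (m : GaussianInt) =
      quarticSym (m : GaussianInt) ⟨2 * A + 1, 2 * B⟩ * iPow ((m - 1) * B) := by
  have hodd := odd_norm_mk A B
  have hrec := quarticSym_reciprocity hodd (even_two_mul B) hm
  rcases mod_four_of_odd hm with h | h
  · rw [primary_of_mod_four_eq_one h] at hrec
    have hexp : (m - 1) * B ≡ 0 [ZMOD 4] :=
      Int.modEq_zero_iff_dvd.2 (Dvd.dvd.mul_right (by omega) B)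
    rw [hrec, iPow_congr hexp, iPow_zero, mul_one]
  · rw [primary_of_mod_four_eq_three h] at hrec
    have hm' : (m : GaussianInt) = iPow 2 * ((-m : ℤ) : GaussianInt) := by
      rw [iPow_two, Int.cast_neg, neg_mul_neg, one_mul]
    conv_lhs => rw [hm', quarticSym_mul_right hodd, hrec, quarticSym_mk_iPow, mul_comm]
    obtain ⟨k, rfl⟩ : ∃ k, m = 4 * k + 3 := ⟨m / 4, by omega⟩
    congr 1
    rw [iPow_inj_zmod]
    push_cast
    generalize (A : ZMod 4) = a; generalize (B : ZMod 4) = b; generalize (k : ZMod 4) = k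
    revert a b k; decide

lemma quarticSym_mk_intCast_sq (A B : ℤ) {m : ℤ} (hm : Odd m) :
    quarticSym ⟨2 * A + 1, 2 * B⟩ (m : GaussianInt) ^ 2 =
      quarticSym (m : GaussianInt) (⟨2 * A + 1, 2 * B⟩ ^ 2) := by
  have hexp : (m - 1) * B * (2 : ℕ) ≡ 0 [ZMOD 4] := by
    obtain ⟨k, rfl⟩ := hm
    exact Int.modEq_zero_iff_dvd.2 ⟨k * B, by push_cast; ring⟩
  rw [quarticSym_mk_intCast A B hm, mul_pow, ← iPow_mul, iPow_congr hexp, iPow_zero, mul_one,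
    quarticSym_pow (odd_norm_intCast.2 hm)]

lemma quarticSym_intCast_of_dvd_re {n : ℤ} {α : GaussianInt} (hn : Odd n) (h : n ∣ α.re)
    (hcop : IsCoprime n α.im) :
    quarticSym (n : GaussianInt) α = quarticSym (n : GaussianInt) (iPow 1) := by
  have hn' := odd_norm_intCast.2 hn
  have hdvd : (n : GaussianInt) ∣ α - iPow 1 * (α.im : GaussianInt) := by
    have he : α - iPow 1 * (α.im : GaussianInt) = (α.re : GaussianInt) := by
      rw [iPow_one]; ext <;> simp
    rw [he]
    exact map_dvd (Int.castRingHom GaussianInt) h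
  rw [quarticSym_congr hn' hdvd, quarticSym_mul_right hn', quarticSym_intCast_intCast hn hcop,
    mul_one]

lemma quarticSym_intCast_one_sub_i {n : ℤ} (hn : Odd n) :
    quarticSym (n : GaussianInt) ⟨1, -1⟩ = iPow (-((primary n - 1) / 4)) := by
  have h := quarticSym_star (odd_norm_intCast.2 hn) ⟨1, 1⟩
  rwa [star_intCast, quarticSym_intCast_one_add_i hn, star_iPow] at h

lemma quarticSym_intCast_add_mk {a b : ℤ} (hodd : Odd (a + b)) (hcop : IsCoprime a b) :
    quarticSym ((a + b : ℤ) : GaussianInt) ⟨a, b⟩ =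
      quarticSym ((a + b : ℤ) : GaussianInt) ⟨1, -1⟩ := by
  have hodd' := odd_norm_intCast.2 hodd
  have hcop' : IsCoprime (a + b) a := by
    have h := hcop.symm.add_mul_left_left 1
    rwa [mul_one, add_comm] at h
  have hdvd : ((a + b : ℤ) : GaussianInt) ∣ ⟨a, b⟩ - ⟨1, -1⟩ * (a : GaussianInt) :=
    ⟨⟨0, 1⟩, by ext <;> simp [add_comm]⟩
  rw [quarticSym_congr hodd' hdvd, quarticSym_mul_right hodd',
    quarticSym_intCast_intCast hodd hcop', mul_one]

/- Modulo `α = a + b i` one has `a ≡ -i b` and `a + b ≡ (1 - i) b`. Evaluating the symbols of `a`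
and `a + b` by reciprocity and eliminating the symbol of `b` leaves a relation for `1 - i`. -/
lemma quarticSym_mk_one_sub_i (A B : ℤ) (h : IsCoprime (2 * A + 1) (2 * B)) :
    quarticSym ⟨2 * A + 1, 2 * B⟩ ⟨1, -1⟩ * iPow (A ^ 2 + A + 2 * A * B) =
      iPow (3 * (A ^ 2 + A + B ^ 2) + 2 * (A + B) * B) *
        quarticSym ((2 * A + 1 + 2 * B : ℤ) : GaussianInt) ⟨1, -1⟩ := by
  have hodd := odd_norm_mk A B
  have ha : Odd (2 * A + 1) := odd_two_mul_add_one A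
  have hab : Odd (2 * A + 1 + 2 * B) := ha.add_even (even_two_mul B)
  set α : GaussianInt := ⟨2 * A + 1, 2 * B⟩ with hα
  have hdvd : α ∣ ((2 * A + 1 : ℤ) : GaussianInt) - iPow 3 * ((2 * B : ℤ) : GaussianInt) :=
    ⟨1, by rw [iPow_three, hα]; ext <;> simp⟩
  have hdvd' :
      α ∣ ((2 * A + 1 + 2 * B : ℤ) : GaussianInt) - ⟨1, -1⟩ * ((2 * B : ℤ) : GaussianInt) :=
    ⟨1, by rw [hα]; ext <;> simp⟩
  have hre := quarticSym_congr hodd hdvd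
  have hsum := quarticSym_congr hodd hdvd'
  rw [quarticSym_mul_right hodd, quarticSym_mk_intCast A B ha,
    quarticSym_intCast_of_dvd_re ha dvd_rfl h, quarticSym_intCast_iPow, quarticSym_mk_iPow,
    ← iPow_add] at hre
  rw [quarticSym_mul_right hodd, quarticSym_mk_intCast A B hab,
    quarticSym_intCast_add_mk hab h] at hsum
  calc quarticSym α ⟨1, -1⟩ * iPow (A ^ 2 + A + 2 * A * B)
      = quarticSym α ⟨1, -1⟩ * iPow (1 * (A ^ 2 + A) + (2 * A + 1 - 1) * B) := by ring_nf
    _ = iPow (3 * (A ^ 2 + A + B ^ 2)) *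
          (quarticSym α ⟨1, -1⟩ * quarticSym α ((2 * B : ℤ) : GaussianInt)) := by
        rw [hre]; ring
    _ = _ := by rw [← hsum, add_sub_right_comm, iPow_add]; ring_nf

lemma quarticSym_intCast_two {n : ℤ} (hn : Odd n) : quarticSym (n : GaussianInt) 2 = 1 := by
  have h := quarticSym_intCast_intCast hn (Int.isCoprime_two_right.2 hn)
  rwa [Int.cast_ofNat] at h

lemma quarticSym_intCast_one_sub_i_sq (A : ℤ) :
    quarticSym ((2 * A + 1 : ℤ) : GaussianInt) ⟨1, -1⟩ ^ 2 = iPow (3 * (A ^ 2 + A)) := by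
  have hA := odd_norm_intCast.2 (odd_two_mul_add_one A)
  have hsq : (⟨1, -1⟩ : GaussianInt) ^ 2 = iPow 3 * 2 := by rw [iPow_three]; decide
  rw [← quarticSym_pow hA, hsq, quarticSym_mul_right hA, quarticSym_intCast_iPow,
    quarticSym_intCast_two (odd_two_mul_add_one A), mul_one]

theorem quarticSym_mk_two (A B : ℤ) (h : IsCoprime (2 * A + 1) (2 * B)) :
    quarticSym ⟨2 * A + 1, 2 * B⟩ 2 = iPow ((2 * A + 1) * B) := by
  have hodd := odd_norm_mk A B
  have hsq := congrArg (· ^ 2) (quarticSym_mk_one_sub_i A B h)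
  simp only [mul_pow, show 2 * A + 1 + 2 * B = 2 * (A + B) + 1 by ring,
    quarticSym_intCast_one_sub_i_sq, ← iPow_mul, ← iPow_add] at hsq
  rw [show (2 : GaussianInt) = iPow 1 * ⟨1, -1⟩ ^ 2 by rw [iPow_one]; decide,
    quarticSym_mul_right hodd, quarticSym_mk_iPow, quarticSym_pow hodd]
  apply (isUnit_iPow ((A ^ 2 + A + 2 * A * B) * (2 : ℕ))).mul_right_cancel
  rw [mul_assoc, hsq, ← iPow_add, ← iPow_add, iPow_inj_zmod]
  push_cast
  generalize (A : ZMod 4) = a; generalize (B : ZMod 4) = b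
  revert a b; decide

lemma quarticSym_one_sub_i_of_mod_four (A B : ℤ) (h : IsCoprime (4 * A + 1) (4 * B)) :
    quarticSym ⟨4 * A + 1, 4 * B⟩ ⟨1, -1⟩ = iPow (-A - B) := by
  have hA : 4 * A + 1 = 2 * (2 * A) + 1 := by ring
  have hB : 4 * B = 2 * (2 * B) := by ring
  rw [hA, hB] at h ⊢
  have hrel := quarticSym_mk_one_sub_i (2 * A) (2 * B) h
  have hAB : 2 * (2 * A) + 1 + 2 * (2 * B) = 4 * (A + B) + 1 := by ring
  rw [hAB, quarticSym_intCast_one_sub_i ⟨2 * (A + B), by ring⟩,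
    primary_of_mod_four_eq_one (by omega), add_sub_cancel_right,
    Int.mul_ediv_cancel_left _ four_ne_zero, ← iPow_add] at hrel
  apply (isUnit_iPow ((2 * A) ^ 2 + 2 * A + 2 * (2 * A) * (2 * B))).mul_right_cancel
  rw [hrel, ← iPow_add, iPow_inj_zmod]
  push_cast
  generalize (A : ZMod 4) = a; generalize (B : ZMod 4) = b
  revert a b; decide

/-! ### The symbol of `ρ + x` -/

lemma quarticSym_intCast_two_pow_mul {n : ℤ} (hn : Odd n) (k : ℕ) (β : GaussianInt) :
    quarticSym (n : GaussianInt) (2 ^ k * β) = quarticSym (n : GaussianInt) β := by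
  have hn' := odd_norm_intCast.2 hn
  rw [quarticSym_mul_right hn', quarticSym_pow hn', quarticSym_intCast_two hn, one_pow, one_mul]

lemma quarticSym_mk_neg_mul_intCast (A B : ℤ) {x n : ℤ} (hx : Odd x) (hn : Odd n) :
    quarticSym ⟨2 * A + 1, 2 * B⟩ ((-(x * n) : ℤ) : GaussianInt) =
      quarticSym (x : GaussianInt) ⟨2 * A + 1, 2 * B⟩ *
        quarticSym (n : GaussianInt) ⟨2 * A + 1, 2 * B⟩ * iPow ((x + n) * B) := by
  have hexp : (-(x * n) - 1) * B ≡ (x + n) * B [ZMOD 4] := by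
    obtain ⟨k, rfl⟩ := hx
    obtain ⟨l, rfl⟩ := hn
    exact Int.modEq_iff_dvd.2 ⟨(k + 1) * (l + 1) * B, by ring⟩
  rw [quarticSym_mk_intCast A B (hx.mul hn).neg, iPow_congr hexp, Int.cast_neg,
    quarticSym_neg_left, Int.cast_mul,
    quarticSym_mul_left (Int.cast_ne_zero.2 (ne_zero_of_odd hx))
      (Int.cast_ne_zero.2 (ne_zero_of_odd hn))]

lemma dvd_intCast_of_dvd_two_mul {β : GaussianInt} (hβ : Odd β.norm) {m : ℤ}
    (h : β ∣ ((2 * m : ℤ) : GaussianInt)) : β ∣ (m : GaussianInt) := by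
  obtain ⟨k, hk⟩ := hβ
  have hnorm : β ∣ ((2 * k + 1 : ℤ) : GaussianInt) :=
    ⟨star β, by rw [← hk, Zsqrtd.norm_eq_mul_conj]⟩
  have hm : (m : GaussianInt) =
      ((2 * k + 1 : ℤ) : GaussianInt) * (m : GaussianInt) - (k : GaussianInt) * (2 * m : ℤ) := by
    push_cast
    ring
  rw [hm]
  exact dvd_sub (hnorm.mul_right _) (h.mul_left _)

/- Modulo `β` the hypothesis reads `q (2 ^ t y) ^ 2 ≡ -x (2 ^ w n)`; take symbols and apply
reciprocity to `q`, `x` and `n`. -/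
lemma quarticSym_mul_sq_eq_of_mk_dvd {q x y n A B : ℤ} {t w : ℕ} (hq : q % 4 = 1) (hx : Odd x)
    (hy : Odd y) (hn : Odd n) (hcop : IsCoprime (2 * A + 1) (2 * B))
    (hdvd : (⟨2 * A + 1, 2 * B⟩ : GaussianInt) ∣
      ((q * (2 ^ t * y) ^ 2 + x * (2 ^ w * n) : ℤ) : GaussianInt)) :
    quarticSym (q : GaussianInt) ⟨2 * A + 1, 2 * B⟩ *
        quarticSym (y : GaussianInt) (⟨2 * A + 1, 2 * B⟩ ^ 2) *
        iPow ((2 * t - w) * ((2 * A + 1) * B)) =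
      quarticSym (x : GaussianInt) ⟨2 * A + 1, 2 * B⟩ *
        quarticSym (n : GaussianInt) ⟨2 * A + 1, 2 * B⟩ * iPow ((x + n) * B) := by
  have hodd := odd_norm_mk A B
  have hrec := quarticSym_reciprocity hodd (even_two_mul B) (Int.odd_iff.2 (by omega) : Odd q)
  rw [primary_of_mod_four_eq_one hq] at hrec
  have htwo := quarticSym_mk_two A B hcop
  have hysq := quarticSym_mk_intCast_sq A B hy
  have hxn := quarticSym_mk_neg_mul_intCast A B hx hn
  set β : GaussianInt := ⟨2 * A + 1, 2 * B⟩
  have hcong : quarticSym β ((q : GaussianInt) * (y : GaussianInt) ^ 2 * 2 ^ (2 * t)) =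
      quarticSym β (((-(x * n) : ℤ) : GaussianInt) * 2 ^ w) := by
    refine quarticSym_congr hodd (hdvd.trans (dvd_of_eq ?_))
    push_cast
    ring
  rw [quarticSym_mul_right hodd, quarticSym_mul_right hodd, quarticSym_mul_right hodd,
    quarticSym_pow hodd, quarticSym_pow hodd, quarticSym_pow hodd, hrec, hysq, htwo, hxn,
    ← iPow_mul, ← iPow_mul] at hcong
  apply (isUnit_iPow ((2 * A + 1) * B * w)).mul_right_cancel
  rw [← hcong, mul_assoc _ (iPow _), ← iPow_add]
  congr 2
  push_cast
  ring

/-- The arithmetic situation in which the symbol of `ρ + x` modulo `q` can be evaluated, where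
`q = 8 Q + 1` and `x = 4 ξ + 1`: the norm of `ρ` is represented by the form `x² + 2 q Y²`, and the
odd part `n` of the real part of `ρ + x` is prime to its imaginary part. The odd part `y` of
`Y = 2 ^ t y` and the power of two in `re ρ + x = 2 ^ w n` are recorded because both enter the
value. -/
structure IsAdmissible (Q ξ y n : ℤ) (t w : ℕ) (ρ : GaussianInt) : Prop where
  odd_y : Odd y
  odd_n : Odd n
  norm_eq : ρ.norm = (4 * ξ + 1) ^ 2 + 2 * (8 * Q + 1) * (2 ^ t * y) ^ 2
  re_add : ρ.re + (4 * ξ + 1) = 2 ^ w * n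
  isCoprime_im : IsCoprime n ρ.im

lemma odd_four_mul_add_one (a : ℤ) : Odd (4 * a + 1) := ⟨2 * a, by ring⟩

lemma quarticSym_four_mul_add_one_iPow (ξ k : ℤ) :
    quarticSym ((4 * ξ + 1 : ℤ) : GaussianInt) (iPow k) = iPow (2 * ξ * k) := by
  rw [show 4 * ξ + 1 = 2 * (2 * ξ) + 1 by ring, quarticSym_intCast_iPow]
  exact iPow_congr (Int.modEq_iff_dvd.2 ⟨-(ξ ^ 2 * k), by ring⟩)

lemma odd_eight_mul_add_one (a : ℤ) : Odd (8 * a + 1) := ⟨4 * a, by ring⟩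

namespace IsAdmissible

variable {Q ξ y n : ℤ} {t w : ℕ} {ρ : GaussianInt}

lemma re_sq_add_im_sq (h : IsAdmissible Q ξ y n t w ρ) :
    ρ.re ^ 2 + ρ.im ^ 2 = (4 * ξ + 1) ^ 2 + 2 * (8 * Q + 1) * (2 ^ t * y) ^ 2 := by
  rw [← h.norm_eq, Zsqrtd.norm_def]
  ring

lemma norm_add (h : IsAdmissible Q ξ y n t w ρ) :
    (ρ + ((4 * ξ + 1 : ℤ) : GaussianInt)).norm =
      2 * ((8 * Q + 1) * (2 ^ t * y) ^ 2 + (4 * ξ + 1) * (2 ^ w * n)) := by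
  rw [Zsqrtd.norm_def, ← h.re_add]
  simp only [Zsqrtd.re_add, Zsqrtd.im_add, Zsqrtd.re_intCast, Zsqrtd.im_intCast]
  linear_combination h.re_sq_add_im_sq

lemma isCoprime_y (h : IsAdmissible Q ξ y n t w ρ) : IsCoprime y n := by
  have hsq : IsCoprime n (ρ.im ^ 2 + n * (2 ^ w * (ρ.re - (4 * ξ + 1)))) :=
    h.isCoprime_im.pow_right.add_mul_left_right _
  have hprod : ρ.im ^ 2 + n * (2 ^ w * (ρ.re - (4 * ξ + 1))) =
      2 * (8 * Q + 1) * 2 ^ (2 * t) * y * y := by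
    linear_combination h.re_sq_add_im_sq - (ρ.re - (4 * ξ + 1)) * h.re_add
  rw [hprod] at hsq
  exact hsq.of_mul_right_right.symm

lemma isCoprime_mk_of_eq (h : IsAdmissible Q ξ y n t w ρ) {δ : GaussianInt} {A B : ℤ}
    (hfac : ρ + ((4 * ξ + 1 : ℤ) : GaussianInt) = δ * ⟨2 * A + 1, 2 * B⟩) :
    IsCoprime (2 * A + 1) (2 * B) := by
  refine isCoprime_of_prime_dvd (fun h0 => by omega) fun ℓ hℓ hA hB => ?_
  have hdvd : ((ℓ : ℤ) : GaussianInt) ∣ ρ + ((4 * ξ + 1 : ℤ) : GaussianInt) :=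
    hfac ▸ Dvd.dvd.mul_left (Zsqrtd.intCast_dvd _ _ |>.2 ⟨hA, hB⟩) δ
  obtain ⟨hre, him⟩ := (Zsqrtd.intCast_dvd _ _).1 hdvd
  simp only [Zsqrtd.re_add, Zsqrtd.im_add, Zsqrtd.re_intCast, Zsqrtd.im_intCast, add_zero,
    h.re_add] at hre him
  have hcop : IsCoprime ℓ (2 ^ w) :=
    ((Int.isCoprime_two_right.2 (odd_two_mul_add_one A)).of_isCoprime_of_dvd_left hA).pow_right
  exact hℓ.not_isUnit (h.isCoprime_im.isUnit_of_dvd' (hcop.dvd_of_dvd_mul_left hre) him)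

lemma quarticSym_y_add_sq (h : IsAdmissible Q ξ y n t w ρ) :
    quarticSym (y : GaussianInt) ((ρ + ((4 * ξ + 1 : ℤ) : GaussianInt)) ^ 2) =
      quarticSym (y : GaussianInt) ρ := by
  have hy := odd_norm_intCast.2 h.odd_y
  have hdvd : (y : GaussianInt) ∣
      (ρ + ((4 * ξ + 1 : ℤ) : GaussianInt)) ^ 2 - 2 ^ (w + 1) * ((n : GaussianInt) * ρ) := by
    have hre := h.re_add
    have hnorm := h.re_sq_add_im_sq
    refine ⟨((-2 * (8 * Q + 1) * 2 ^ (2 * t) * y : ℤ) : GaussianInt), ?_⟩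
    rw [show (2 : GaussianInt) ^ (w + 1) = ((2 * 2 ^ w : ℤ) : GaussianInt) by push_cast; ring]
    ext
    · simp only [pow_two, Zsqrtd.re_add, Zsqrtd.im_add, Zsqrtd.re_sub, Zsqrtd.re_mul,
        Zsqrtd.im_mul, Zsqrtd.re_intCast, Zsqrtd.im_intCast]
      linear_combination 2 * ρ.re * hre - hnorm
    · simp only [pow_two, Zsqrtd.re_add, Zsqrtd.im_add, Zsqrtd.im_sub, Zsqrtd.re_mul,
        Zsqrtd.im_mul, Zsqrtd.re_intCast, Zsqrtd.im_intCast]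
      linear_combination 2 * ρ.im * hre
  rw [quarticSym_congr hy hdvd, quarticSym_intCast_two_pow_mul h.odd_y, quarticSym_mul_right hy,
    quarticSym_intCast_intCast h.odd_y h.isCoprime_y, one_mul]

lemma quarticSym_x_add :
    quarticSym ((4 * ξ + 1 : ℤ) : GaussianInt) (ρ + ((4 * ξ + 1 : ℤ) : GaussianInt)) =
      quarticSym ((4 * ξ + 1 : ℤ) : GaussianInt) ρ :=
  quarticSym_congr (odd_norm_intCast.2 (odd_four_mul_add_one ξ)) ⟨1, by ring⟩

lemma quarticSym_n_add (h : IsAdmissible Q ξ y n t w ρ) :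
    quarticSym (n : GaussianInt) (ρ + ((4 * ξ + 1 : ℤ) : GaussianInt)) =
      quarticSym (n : GaussianInt) (iPow 1) := by
  apply quarticSym_intCast_of_dvd_re h.odd_n
  · rw [Zsqrtd.re_add, Zsqrtd.re_intCast, h.re_add]
    exact dvd_mul_left n _
  · rw [Zsqrtd.im_add, Zsqrtd.im_intCast, add_zero]
    exact h.isCoprime_im

theorem quarticSym_add_of_eq_mul (h : IsAdmissible Q ξ y n t w ρ) {v : ℕ} {γ : GaussianInt}
    {A B : ℤ}
    (hfac : ρ + ((4 * ξ + 1 : ℤ) : GaussianInt) = 2 ^ v * (γ * ⟨2 * A + 1, 2 * B⟩)) :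
    quarticSym ((8 * Q + 1 : ℤ) : GaussianInt) (ρ + ((4 * ξ + 1 : ℤ) : GaussianInt)) *
        quarticSym (y : GaussianInt) ρ * iPow ((2 * t - w) * ((2 * A + 1) * B)) *
        (quarticSym ((4 * ξ + 1 : ℤ) : GaussianInt) γ * quarticSym (n : GaussianInt) γ) =
      quarticSym ((4 * ξ + 1 : ℤ) : GaussianInt) ρ * quarticSym (n : GaussianInt) (iPow 1) *
        iPow ((1 + n) * B) * (quarticSym ((8 * Q + 1 : ℤ) : GaussianInt) γ *
          quarticSym (y : GaussianInt) (γ ^ 2)) := by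
  have hx := odd_four_mul_add_one ξ
  have hq := odd_eight_mul_add_one Q
  have hβ : IsCoprime (2 * A + 1) (2 * B) :=
    h.isCoprime_mk_of_eq (δ := 2 ^ v * γ) (by rw [hfac, mul_assoc])
  have hdvd : (⟨2 * A + 1, 2 * B⟩ : GaussianInt) ∣
      (((8 * Q + 1) * (2 ^ t * y) ^ 2 + (4 * ξ + 1) * (2 ^ w * n) : ℤ) : GaussianInt) := by
    refine dvd_intCast_of_dvd_two_mul (odd_norm_mk A B) (?_ : _ ∣ ((2 * _ : ℤ) : GaussianInt))
    rw [← h.norm_add, Zsqrtd.norm_eq_mul_conj, hfac, ← mul_assoc]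
    exact Dvd.dvd.mul_right (dvd_mul_left _ _) _
  have hmain := quarticSym_mul_sq_eq_of_mk_dvd (by omega) hx h.odd_y h.odd_n hβ hdvd
  have hsplit (m : ℤ) (hm : Odd m) :
      quarticSym (m : GaussianInt) (ρ + ((4 * ξ + 1 : ℤ) : GaussianInt)) =
        quarticSym (m : GaussianInt) γ * quarticSym (m : GaussianInt) ⟨2 * A + 1, 2 * B⟩ := by
    rw [hfac, quarticSym_intCast_two_pow_mul hm, quarticSym_mul_right (odd_norm_intCast.2 hm)]
  have hexp : (4 * ξ + 1 + n) * B ≡ (1 + n) * B [ZMOD 4] :=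
    Int.modEq_iff_dvd.2 ⟨-(ξ * B), by ring⟩
  have hy := odd_norm_intCast.2 h.odd_y
  rw [iPow_congr hexp] at hmain
  rw [← h.quarticSym_y_add_sq, ← quarticSym_x_add (ρ := ρ), ← h.quarticSym_n_add,
    quarticSym_pow hy, quarticSym_pow hy, hsplit _ hq, hsplit _ hx, hsplit _ h.odd_n,
    hsplit _ h.odd_y]
  rw [quarticSym_pow hy] at hmain
  linear_combination (quarticSym ((8 * Q + 1 : ℤ) : GaussianInt) γ *
    quarticSym (y : GaussianInt) γ ^ 2 * quarticSym ((4 * ξ + 1 : ℤ) : GaussianInt) γ *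
    quarticSym (n : GaussianInt) γ) * hmain

end IsAdmissible

lemma eq_mul_iPow_of_mul_eq {z w : GaussianInt} {a b c : ℤ} (h : z * iPow a = w * iPow b)
    (hc : c + a ≡ b [ZMOD 4]) : z = w * iPow c := by
  apply (isUnit_iPow a).mul_right_cancel
  rw [h, mul_assoc, ← iPow_add, iPow_congr hc]

lemma add_intCast_eq_two_pow_mul {ρ : GaussianInt} {x a b : ℤ} {k : ℕ}
    (hre : ρ.re + x = 2 ^ k * a) (him : ρ.im = 2 ^ k * b) :
    ρ + (x : GaussianInt) = 2 ^ k * ⟨a, b⟩ := by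
  rw [show (2 : GaussianInt) ^ k = ((2 ^ k : ℤ) : GaussianInt) by push_cast; rfl]
  ext
  · simp only [Zsqrtd.re_add, Zsqrtd.re_intCast, Zsqrtd.re_smul, hre]
  · simp only [Zsqrtd.im_add, Zsqrtd.im_intCast, Zsqrtd.im_smul, him, add_zero]

namespace IsAdmissible

variable {Q ξ y n A B : ℤ} {t w : ℕ} {ρ : GaussianInt}

lemma quarticSym_add_of_lt (h : IsAdmissible Q ξ y (2 * A + 1) t w ρ)
    (him : ρ.im = 2 ^ w * (2 * B)) :
    quarticSym ((8 * Q + 1 : ℤ) : GaussianInt) (ρ + ((4 * ξ + 1 : ℤ) : GaussianInt)) *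
        quarticSym (y : GaussianInt) ρ =
      quarticSym ((4 * ξ + 1 : ℤ) : GaussianInt) ρ *
        iPow (A ^ 2 + A + (2 * A + 2) * B - (2 * t - w) * ((2 * A + 1) * B)) := by
  have hfac : ρ + ((4 * ξ + 1 : ℤ) : GaussianInt) = 2 ^ w * (1 * ⟨2 * A + 1, 2 * B⟩) := by
    rw [one_mul, add_intCast_eq_two_pow_mul h.re_add him]
  have hmain := h.quarticSym_add_of_eq_mul hfac
  rw [one_pow, quarticSym_one (odd_norm_intCast.2 h.odd_n),
    quarticSym_one (odd_norm_intCast.2 h.odd_y),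
    quarticSym_one (odd_norm_intCast.2 (odd_four_mul_add_one ξ)),
    quarticSym_one (odd_norm_intCast.2 (odd_eight_mul_add_one Q)), quarticSym_intCast_iPow,
    mul_one, mul_one, mul_one, mul_assoc _ (iPow _), ← iPow_add] at hmain
  exact eq_mul_iPow_of_mul_eq hmain (congrArg (· % 4) (by ring))

lemma quarticSym_add_of_gt (h : IsAdmissible Q ξ y n t w ρ) {u : ℕ}
    (him : ρ.im = 2 ^ u * (2 * A + 1)) (hn : 2 ^ w * n = 2 ^ u * (-(2 * B))) :
    quarticSym ((8 * Q + 1 : ℤ) : GaussianInt) (ρ + ((4 * ξ + 1 : ℤ) : GaussianInt)) *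
        quarticSym (y : GaussianInt) ρ =
      quarticSym ((4 * ξ + 1 : ℤ) : GaussianInt) ρ *
        iPow ((1 + n) * B - (2 * t - w) * ((2 * A + 1) * B) - 2 * ξ) := by
  have hfac : ρ + ((4 * ξ + 1 : ℤ) : GaussianInt) = 2 ^ u * (iPow 1 * ⟨2 * A + 1, 2 * B⟩) := by
    have hmul : iPow 1 * ⟨2 * A + 1, 2 * B⟩ = ⟨-(2 * B), 2 * A + 1⟩ := by
      rw [iPow_one]; ext <;> simp
    rw [hmul, add_intCast_eq_two_pow_mul (h.re_add.trans hn) him]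
  have hmain := h.quarticSym_add_of_eq_mul hfac
  obtain ⟨z, hz⟩ := h.odd_y
  have hysq : quarticSym (y : GaussianInt) (iPow 1 ^ 2) = iPow 0 := by
    rw [← iPow_mul, hz, quarticSym_intCast_iPow]
    obtain ⟨k, hk⟩ := Int.even_mul_succ_self z
    exact iPow_congr (Int.modEq_iff_dvd.2 ⟨-k, by push_cast; linear_combination (-2) * hk⟩)
  have hq : quarticSym ((8 * Q + 1 : ℤ) : GaussianInt) (iPow 1) = iPow 0 := by
    rw [show 8 * Q + 1 = 4 * (2 * Q) + 1 by ring, quarticSym_four_mul_add_one_iPow]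
    exact iPow_congr (Int.modEq_iff_dvd.2 ⟨-Q, by ring⟩)
  have hni : IsUnit (quarticSym (n : GaussianInt) (iPow 1)) :=
    quarticSym_iPow (odd_norm_intCast.2 h.odd_n) 1 ▸ isUnit_iPow _
  refine eq_mul_iPow_of_mul_eq (a := (2 * t - w) * ((2 * A + 1) * B) + 2 * ξ)
    (b := (1 + n) * B) (hni.mul_right_cancel ?_) (congrArg (· % 4) (by ring))
  rw [hysq, quarticSym_four_mul_add_one_iPow, hq, iPow_zero, mul_one, mul_one, mul_one] at hmain
  rw [iPow_add]
  linear_combination hmain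

lemma quarticSym_add_of_eq (h : IsAdmissible Q ξ y n t w ρ) (hn : n = 2 * A + 1 - 2 * B)
    (him : ρ.im = 2 ^ w * (2 * A + 1 + 2 * B)) :
    quarticSym ((8 * Q + 1 : ℤ) : GaussianInt) (ρ + ((4 * ξ + 1 : ℤ) : GaussianInt)) *
        quarticSym (y : GaussianInt) ρ =
      quarticSym ((4 * ξ + 1 : ℤ) : GaussianInt) ρ * quarticSym (y : GaussianInt) (iPow 1) *
        iPow ((primary n - 1) / 4 + (1 + n) * B - (2 * t - w) * ((2 * A + 1) * B) - ξ +
          2 * Q) := by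
  have hfac : ρ + ((4 * ξ + 1 : ℤ) : GaussianInt) = 2 ^ w * (⟨1, 1⟩ * ⟨2 * A + 1, 2 * B⟩) := by
    have hmul : (⟨1, 1⟩ : GaussianInt) * ⟨2 * A + 1, 2 * B⟩ = ⟨n, 2 * A + 1 + 2 * B⟩ := by
      rw [hn]; ext <;> simp <;> ring
    rw [hmul, add_intCast_eq_two_pow_mul h.re_add him]
  have hmain := h.quarticSym_add_of_eq_mul hfac
  have hsq {m : ℤ} (hm : Odd m) :
      quarticSym (m : GaussianInt) (⟨1, 1⟩ ^ 2) = quarticSym (m : GaussianInt) (iPow 1) := by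
    rw [show (⟨1, 1⟩ : GaussianInt) ^ 2 = 2 ^ 1 * iPow 1 by rw [iPow_one]; decide,
      quarticSym_intCast_two_pow_mul hm]
  have hx : quarticSym ((4 * ξ + 1 : ℤ) : GaussianInt) ⟨1, 1⟩ = iPow ξ := by
    rw [quarticSym_intCast_one_add_i (odd_four_mul_add_one ξ),
      primary_of_mod_four_eq_one (by omega), show (4 * ξ + 1 - 1) / 4 = ξ by omega]
  have hq : quarticSym ((8 * Q + 1 : ℤ) : GaussianInt) ⟨1, 1⟩ = iPow (2 * Q) := by
    rw [quarticSym_intCast_one_add_i (odd_eight_mul_add_one Q),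
      primary_of_mod_four_eq_one (by omega), show (8 * Q + 1 - 1) / 4 = 2 * Q by omega]
  rw [hsq h.odd_y, ← hsq h.odd_n, quarticSym_pow (odd_norm_intCast.2 h.odd_n), hx, hq,
    quarticSym_intCast_one_add_i h.odd_n] at hmain
  refine eq_mul_iPow_of_mul_eq
    (a := (2 * t - w) * ((2 * A + 1) * B) + (ξ + (primary n - 1) / 4))
    (b := (primary n - 1) / 4 * (2 : ℕ) + (1 + n) * B + 2 * Q) ?_
    (congrArg (· % 4) (by push_cast; ring))
  rw [iPow_add, iPow_add, iPow_add, iPow_add, iPow_mul]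
  linear_combination hmain

end IsAdmissible

/-! ### The symbols of `i ^ j π + x` modulo `q` -/

section NormRelation

variable {c d ξ Q y : ℤ} {s : ℕ}

lemma isAdmissible_iPow_mul (hy : Odd y)
    (hrel : 2 * c ^ 2 + c + 2 * d ^ 2 = 2 * ξ ^ 2 + ξ + (8 * Q + 1) * (2 ^ s * y) ^ 2) (j : ℤ)
    {a b n : ℤ} {w : ℕ} (hj : iPow j * ⟨4 * c + 1, 4 * d⟩ = ⟨a, b⟩) (hn : Odd n)
    (hre : a + (4 * ξ + 1) = 2 ^ w * n) (hcop : IsCoprime n b) :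
    IsAdmissible Q ξ y n (s + 1) w (iPow j * ⟨4 * c + 1, 4 * d⟩) where
  odd_y := hy
  odd_n := hn
  norm_eq := by
    rw [Zsqrtd.norm_mul, norm_mk (4 * c + 1),
      (Zsqrtd.norm_eq_one_iff' (by norm_num) _).2 (isUnit_iPow j)]
    linear_combination 8 * hrel
  re_add := by rw [hj]; exact hre
  isCoprime_im := by rw [hj]; exact hcop

lemma two_dvd_mul_sub_of_rel
    (hrel : 2 * c ^ 2 + c + 2 * d ^ 2 = 2 * ξ ^ 2 + ξ + (8 * Q + 1) * (2 ^ s * y) ^ 2) :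
    2 ∣ s * (c - ξ) := by
  cases s with
  | zero => exact ⟨0, by push_cast; ring⟩
  | succ k =>
    refine Dvd.dvd.mul_left ⟨ξ ^ 2 - c ^ 2 - d ^ 2 + (8 * Q + 1) * 2 * (2 ^ k * y) ^ 2, ?_⟩ _
    rw [pow_succ] at hrel
    linear_combination hrel

/-- The value of the quartic symbol of `i ^ j * π + x` modulo `q` in terms of the symbols of `π`
modulo `x` and `y`, where `π = (4 * c + 1) + 4 * d * i`, `x = 4 * ξ + 1` and `q = 8 * Q + 1`; the
representation of `N(π)` is `x ^ 2 + 2 * q * (2 ^ (s + 1) * y) ^ 2`. -/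
def SymbolFormula (Q ξ y c d : ℤ) (s : ℕ) (j : ℤ) : Prop :=
  quarticSym ((8 * Q + 1 : ℤ) : GaussianInt)
      (iPow j * ⟨4 * c + 1, 4 * d⟩ + ((4 * ξ + 1 : ℤ) : GaussianInt)) *
      quarticSym (y : GaussianInt) ⟨4 * c + 1, 4 * d⟩ =
    quarticSym ((4 * ξ + 1 : ℤ) : GaussianInt) ⟨4 * c + 1, 4 * d⟩ *
      iPow (d - 2 * ξ - 2 * (s + 1) * d + 2 * Q * j)

lemma symbolFormula_one (hy : Odd y)
    (hrel : 2 * c ^ 2 + c + 2 * d ^ 2 = 2 * ξ ^ 2 + ξ + (8 * Q + 1) * (2 ^ s * y) ^ 2)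
    (hcop : IsCoprime (4 * c + 1) (4 * ξ + 1 - 4 * d)) : SymbolFormula Q ξ y c d s 1 := by
  have hj : iPow 1 * ⟨4 * c + 1, 4 * d⟩ = ⟨-(4 * d), 4 * c + 1⟩ := by
    rw [iPow_one]; ext <;> simp
  have hadm := isAdmissible_iPow_mul (n := 4 * ξ + 1 - 4 * d) (w := 0) hy hrel 1 hj
    ⟨2 * (ξ - d), by ring⟩ (by ring) hcop.symm
  have hval := hadm.quarticSym_add_of_eq (A := c + ξ - d) (B := c + d - ξ) (by ring)
    (by rw [hj]; ring)
  have hyi : IsUnit (quarticSym (y : GaussianInt) (iPow 1)) :=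
    quarticSym_iPow (odd_norm_intCast.2 hy) 1 ▸ isUnit_iPow _
  obtain ⟨k, hk⟩ := two_dvd_mul_sub_of_rel hrel
  rw [quarticSym_mul_right (odd_norm_intCast.2 hy), quarticSym_mul_right
    (odd_norm_intCast.2 (odd_four_mul_add_one ξ)), quarticSym_four_mul_add_one_iPow,
    primary_of_mod_four_eq_one (by omega),
    show (4 * ξ + 1 - 4 * d - 1) / 4 = ξ - d by omega] at hval
  refine eq_mul_iPow_of_mul_eq (a := 0) (b := 2 * ξ * 1 + (ξ - d +
    (1 + (4 * ξ + 1 - 4 * d)) * (c + d - ξ) - (2 * (s + 1 : ℕ) - (0 : ℕ)) *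
    ((2 * (c + ξ - d) + 1) * (c + d - ξ)) - ξ + 2 * Q)) (hyi.mul_right_cancel ?_)
    (Int.modEq_iff_dvd.2 ⟨ξ + (ξ - d) * (c + d - ξ) - (s + 1) * (c + ξ - d) * (c + d - ξ) - k,
      by push_cast; linear_combination (-2) * hk⟩)
  rw [iPow_add, iPow_zero]
  linear_combination hval

lemma SymbolFormula.neg (hy : Odd y) {j : ℤ} (h : SymbolFormula Q ξ y c (-d) s j) :
    SymbolFormula Q ξ y c d s (-j) := by
  have hstar : (⟨4 * c + 1, 4 * -d⟩ : GaussianInt) = star ⟨4 * c + 1, 4 * d⟩ := by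
    ext
    · rfl
    · exact mul_neg 4 d
  have hsym {n : ℤ} (hn : Odd n) (β : GaussianInt) :
      quarticSym (n : GaussianInt) (star β) = star (quarticSym (n : GaussianInt) β) := by
    rw [← quarticSym_star (odd_norm_intCast.2 hn), star_intCast]
  unfold SymbolFormula at h ⊢
  rw [hstar, show iPow j * star (⟨4 * c + 1, 4 * d⟩ : GaussianInt) + ((4 * ξ + 1 : ℤ) :
      GaussianInt) = star (iPow (-j) * ⟨4 * c + 1, 4 * d⟩ + ((4 * ξ + 1 : ℤ) : GaussianInt)) by
    rw [star_add, star_mul', star_iPow, neg_neg, star_intCast], hsym (odd_eight_mul_add_one Q),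
    hsym hy, hsym (odd_four_mul_add_one ξ)] at h
  have h' := congrArg star h
  rw [star_mul', star_mul', star_star, star_star, star_star, star_iPow] at h'
  exact h'.trans (congrArg _ (iPow_congr (Int.modEq_iff_dvd.2 ⟨-ξ, by ring⟩)))

lemma isCoprime_four_mul {n d : ℤ} (hn : Odd n) (h : IsCoprime n d) : IsCoprime n (4 * d) :=
  IsCoprime.mul_right ((Int.isCoprime_two_right.2 hn).pow_right (n := 2)) h

lemma sq_add_modEq_zero_of_rel {u : ℤ}
    (hrel : 2 * c ^ 2 + c + 2 * d ^ 2 = 2 * ξ ^ 2 + ξ + (8 * Q + 1) * u ^ 2) :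
    (ξ + c) ^ 2 + (ξ + c) + 2 * d + 2 * ξ ≡ 0 [ZMOD 4] := by
  have key : ∀ u c d ξ : ZMod 4, 2 * c ^ 2 + c + 2 * d ^ 2 = 2 * ξ ^ 2 + ξ + u ^ 2 →
    (ξ + c) ^ 2 + (ξ + c) + 2 * d + 2 * ξ = 0 := by decide
  have hcast := congrArg (Int.cast : ℤ → ZMod 4) hrel
  rw [show (8 * Q + 1) * u ^ 2 = 4 * (2 * Q * u ^ 2) + u ^ 2 by ring] at hcast
  push_cast at hcast
  rw [show (4 : ZMod 4) = 0 from rfl, zero_mul, zero_add] at hcast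
  exact (ZMod.intCast_eq_intCast_iff _ _ 4).1 (by exact_mod_cast key _ _ _ _ hcast)

lemma symbolFormula_zero (hy : Odd y)
    (hrel : 2 * c ^ 2 + c + 2 * d ^ 2 = 2 * ξ ^ 2 + ξ + (8 * Q + 1) * (2 ^ s * y) ^ 2)
    (hcop : IsCoprime (2 * (ξ + c) + 1) d) : SymbolFormula Q ξ y c d s 0 := by
  have hj : iPow 0 * ⟨4 * c + 1, 4 * d⟩ = ⟨4 * c + 1, 4 * d⟩ := by rw [iPow_zero, one_mul]
  have hodd := odd_two_mul_add_one (ξ + c)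
  have hadm := isAdmissible_iPow_mul (n := 2 * (ξ + c) + 1) (w := 1) hy hrel 0 hj hodd (by ring)
    (isCoprime_four_mul hodd hcop)
  have hval := hadm.quarticSym_add_of_lt (B := d) (by rw [hj]; ring)
  obtain ⟨k, hk⟩ := (sq_add_modEq_zero_of_rel hrel).dvd
  rw [iPow_zero, one_mul] at hval
  rw [SymbolFormula, iPow_zero, one_mul, hval]
  exact congrArg _ (iPow_congr (Int.modEq_iff_dvd.2
    ⟨k - (ξ + c) * d + (s + 1) * (ξ + c) * d, by push_cast; linear_combination hk⟩))

lemma isAdmissible_iPow_two_mul (hy : Odd y)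
    (hrel : 2 * c ^ 2 + c + 2 * d ^ 2 = 2 * ξ ^ 2 + ξ + (8 * Q + 1) * (2 ^ s * y) ^ 2)
    {n : ℤ} {v : ℕ} (hn : Odd n) (hv : ξ - c = 2 ^ v * n) (hcop : IsCoprime n d) :
    IsAdmissible Q ξ y n (s + 1) (v + 2) (iPow 2 * ⟨4 * c + 1, 4 * d⟩) :=
  isAdmissible_iPow_mul (a := -(4 * c + 1)) hy hrel 2
    (by rw [iPow_two]; ext <;> simp) hn (by linear_combination 4 * hv)
    (isCoprime_four_mul hn hcop).neg_right

lemma im_iPow_two_mul (a b : ℤ) : (iPow 2 * ⟨a, b⟩).im = -b := by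
  rw [iPow_two]; simp

lemma symbolFormula_two_of_eq (hy : Odd y) {E : ℤ}
    (h : quarticSym ((8 * Q + 1 : ℤ) : GaussianInt)
        (iPow 2 * ⟨4 * c + 1, 4 * d⟩ + ((4 * ξ + 1 : ℤ) : GaussianInt)) *
        quarticSym (y : GaussianInt) (iPow 2 * ⟨4 * c + 1, 4 * d⟩) =
      quarticSym ((4 * ξ + 1 : ℤ) : GaussianInt) (iPow 2 * ⟨4 * c + 1, 4 * d⟩) * iPow E)
    (hE : E ≡ d - 2 * ξ - 2 * (s + 1) * d [ZMOD 4]) : SymbolFormula Q ξ y c d s 2 := by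
  have hneg {m : ℤ} (hm : Odd m) (β : GaussianInt) :
      quarticSym (m : GaussianInt) (iPow 2 * β) = quarticSym (m : GaussianInt) β := by
    rw [quarticSym_mul_right (odd_norm_intCast.2 hm), iPow_two, quarticSym_intCast_neg_one hm,
      one_mul]
  rw [hneg hy, hneg (odd_four_mul_add_one ξ)] at h
  rw [SymbolFormula, h]
  exact congrArg _ (iPow_congr (hE.trans (Int.modEq_iff_dvd.2 ⟨Q, by ring⟩)))

lemma quotient_rel
    (hrel : 2 * c ^ 2 + c + 2 * d ^ 2 = 2 * ξ ^ 2 + ξ + (8 * Q + 1) * (2 ^ s * y) ^ 2)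
    {n D : ℤ} (hv : ξ - c = 2 ^ (2 * s) * n) (hd : d = 2 ^ s * D) :
    n * (4 * ξ + 1 - 2 * 2 ^ (2 * s) * n) = 2 * D ^ 2 - (8 * Q + 1) * y ^ 2 := by
  apply mul_left_cancel₀ (pow_ne_zero (2 * s) two_ne_zero)
  obtain rfl : c = ξ - 2 ^ (2 * s) * n := by linear_combination -hv
  subst hd
  linear_combination -hrel

lemma exists_sq_eq_eight_mul_add_one {n : ℤ} (hn : Odd n) : ∃ m, n ^ 2 = 8 * m + 1 := by
  obtain ⟨k, rfl⟩ := hn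
  obtain ⟨m, hm⟩ := Int.even_mul_succ_self k
  exact ⟨m, by linear_combination 4 * hm⟩

lemma four_dvd_four_pow_mul_sub_one (s : ℕ) : (4 : ℤ) ∣ 2 ^ (2 * s) * (2 ^ (2 * s) - 1) := by
  cases s with
  | zero => exact ⟨0, rfl⟩
  | succ k => exact ⟨2 ^ (2 * k) * (2 ^ (2 * (k + 1)) - 1), by ring⟩

lemma two_dvd_mul_two_pow (e : ℕ) : (2 : ℤ) ∣ e * 2 ^ e := by
  cases e with
  | zero => exact ⟨0, by simp⟩
  | succ k => exact Dvd.dvd.mul_left (dvd_pow_self 2 k.succ_ne_zero) _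

lemma symbolFormula_two_of_valuation_lt (hy : Odd y)
    (hrel : 2 * c ^ 2 + c + 2 * d ^ 2 = 2 * ξ ^ 2 + ξ + (8 * Q + 1) * (2 ^ s * y) ^ 2)
    {n G : ℤ} (hn : Odd n) (hv : ξ - c = 2 ^ (2 * s) * n) (hd : d = 2 ^ (2 * s) * (2 * G))
    (hcop : IsCoprime n d) : SymbolFormula Q ξ y c d s 2 := by
  obtain ⟨m, hm⟩ := exists_sq_eq_eight_mul_add_one hy
  obtain ⟨k, hk⟩ := four_dvd_four_pow_mul_sub_one s
  have hquot := quotient_rel hrel hv (D := 2 ^ s * (2 * G)) (by rw [hd]; ring)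
  obtain ⟨A, rfl⟩ := hn
  have hval := (isAdmissible_iPow_two_mul hy hrel ⟨A, rfl⟩ hv hcop).quarticSym_add_of_lt (B := -G)
    (by rw [im_iPow_two_mul, hd]; ring)
  obtain ⟨K, hK⟩ : ∃ K, A = 2 ^ (2 * s) - 1 - 2 * ξ + 4 * K := by
    refine ⟨2 ^ (2 * s) * (G ^ 2 + A * (A + 1)) - 8 * Q * m - Q - m - ξ * A, ?_⟩
    apply mul_left_cancel₀ (two_ne_zero (α := ℤ))
    rw [hm] at hquot
    linear_combination hquot
  refine symbolFormula_two_of_eq hy hval (Int.modEq_iff_dvd.2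
    ⟨-s * 2 ^ (2 * s) * G - ξ - k + ξ * 2 ^ (2 * s) - ξ ^ 2 - K * (2 * 2 ^ (2 * s) - 1 - 4 * ξ) -
      4 * K ^ 2 - ξ * G + 2 * K * G, ?_⟩)
  rw [hd, hK]
  push_cast
  linear_combination -hk

lemma symbolFormula_two_of_valuation_eq (hy : Odd y)
    (hrel : 2 * c ^ 2 + c + 2 * d ^ 2 = 2 * ξ ^ 2 + ξ + (8 * Q + 1) * (2 ^ s * y) ^ 2)
    {n δ : ℤ} (hn : Odd n) (hv : ξ - c = 2 ^ (2 * s) * n) (hd : d = 2 ^ (2 * s) * (4 * δ + 1))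
    (hcop : IsCoprime n d) : SymbolFormula Q ξ y c d s 2 := by
  have hquot := quotient_rel hrel hv (D := 2 ^ s * (4 * δ + 1)) (by rw [hd]; ring)
  have hadm := isAdmissible_iPow_two_mul hy hrel hn hv hcop
  obtain ⟨z, rfl⟩ := hy
  obtain ⟨m, hm⟩ := Int.even_mul_succ_self z
  obtain ⟨k, hk⟩ := two_dvd_mul_two_pow s
  obtain ⟨l, rfl⟩ : ∃ l, n = -4 * l - 1 := by
    obtain ⟨a, rfl⟩ := hn
    refine ⟨2 * a * ξ + ξ - 2 ^ (2 * s) * (2 * a * (a + 1) + 1 + 8 * δ ^ 2 + 4 * δ) + 16 * Q * m +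
      2 * Q + 2 * m, ?_⟩
    linear_combination hquot - 4 * (8 * Q + 1) * hm
  obtain ⟨K, hK⟩ : ∃ K, l = -ξ - 2 ^ (2 * s) + 2 * Q + 2 * m + 4 * K := by
    refine ⟨-l * ξ - 2 ^ (2 * s) * (l * (2 * l + 1) + 2 * δ ^ 2 + δ) + 4 * Q * m, ?_⟩
    apply mul_left_cancel₀ (four_ne_zero (α := ℤ))
    linear_combination -hquot + 4 * (8 * Q + 1) * hm
  have hval := hadm.quarticSym_add_of_eq (A := -1 - l - δ) (B := l - δ) (by ring)
    (by rw [im_iPow_two_mul, hd]; ring)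
  rw [quarticSym_intCast_iPow, primary_of_mod_four_eq_three (by omega),
    show (-(-4 * l - 1) - 1) / 4 = l by omega, mul_assoc _ (iPow _) (iPow _), ← iPow_add] at hval
  refine symbolFormula_two_of_eq (odd_two_mul_add_one z) hval (Int.modEq_iff_dvd.2
    ⟨-k * 2 ^ s - 2 ^ (2 * s) * δ * (2 * s + 1) - m - Q - K + l * (l - δ), ?_⟩)
  rw [hd]
  push_cast
  linear_combination -hK - hm - 2 * 2 ^ s * hk

lemma symbolFormula_two_of_valuation_gt (hy : Odd y)
    (hrel : 2 * c ^ 2 + c + 2 * d ^ 2 = 2 * ξ ^ 2 + ξ + (8 * Q + 1) * (2 ^ s * y) ^ 2)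
    {n δ : ℤ} {e g : ℕ} (hn : Odd n) (hv : ξ - c = 2 ^ (e + g + 1) * n)
    (hd : d = 2 ^ e * (4 * δ + 1)) (hcop : IsCoprime n d)
    (hmod : 2 ^ g * n * (n + 2 * s - e - g) ≡ 2 ^ e * (2 * s + 1) [ZMOD 4]) :
    SymbolFormula Q ξ y c d s 2 := by
  have hval := (isAdmissible_iPow_two_mul hy hrel hn hv hcop).quarticSym_add_of_gt
    (A := -2 * δ - 1) (B := -(2 ^ g * n)) (u := e + 2)
    (by rw [im_iPow_two_mul, hd]; ring) (by ring)
  refine symbolFormula_two_of_eq hy hval ?_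
  obtain ⟨k, hk⟩ := hmod.dvd
  rw [hd]
  refine Int.modEq_iff_dvd.2 ⟨-k + δ * ((2 * s - e - g - 1) * n * 2 ^ g - (2 * s + 1) * 2 ^ e), ?_⟩
  push_cast
  linear_combination -hk

lemma eq_of_two_pow_mul_eq {v w : ℕ} {a b : ℤ} (ha : Odd a) (hb : Odd b)
    (h : 2 ^ v * a = 2 ^ w * b) : v = w := by
  have key {v w : ℕ} {a b : ℤ} (ha : Odd a) (h : 2 ^ v * a = 2 ^ w * b) : w ≤ v := by
    have hcop : IsCoprime (2 ^ w) a := (Int.isCoprime_two_left.2 ha).pow_left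
    exact (pow_dvd_pow_iff (by norm_num) Int.prime_two.not_isUnit).1
      (hcop.dvd_of_dvd_mul_right ⟨b, h⟩)
  exact le_antisymm (key hb h.symm) (key ha h)

lemma exists_eq_two_pow_mul_odd_int {z : ℤ} (hz : z ≠ 0) :
    ∃ (v : ℕ) (n : ℤ), z = 2 ^ v * n ∧ Odd n := by
  obtain ⟨n, hn, hdvd⟩ :=
    (Int.finiteMultiplicity_iff (a := 2).2 ⟨by norm_num, hz⟩).exists_eq_pow_mul_and_not_dvd
  exact ⟨_, n, hn, Int.not_even_iff_odd.1 fun h => hdvd h.two_dvd⟩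

lemma valuation_sub_of_rel {n m : ℤ} {e v : ℕ} (hy : Odd y)
    (hrel : 2 * c ^ 2 + c + 2 * d ^ 2 = 2 * ξ ^ 2 + ξ + (8 * Q + 1) * (2 ^ s * y) ^ 2)
    (hv : ξ - c = 2 ^ v * n) (hn : Odd n) (hd : d = 2 ^ e * m) (hm : Odd m) :
    s ≤ e ∧ v = 2 * s ∨ e < s ∧ v = 2 * e + 1 := by
  have hfac : 2 ^ v * (n * (2 * (ξ + c) + 1)) = 2 * d ^ 2 - (8 * Q + 1) * (2 ^ s * y) ^ 2 := by
    linear_combination -(2 * (ξ + c) + 1) * hv - hrel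
  have hodd := hn.mul (odd_two_mul_add_one (ξ + c))
  rcases le_or_gt s e with h | h
  · obtain ⟨k, rfl⟩ := Nat.exists_eq_add_of_le h
    refine .inl ⟨h, eq_of_two_pow_mul_eq hodd (b := 2 * (2 ^ k * m) ^ 2 - (8 * Q + 1) * y ^ 2)
      ((even_two_mul _).sub_odd ((odd_eight_mul_add_one Q).mul hy.pow)) ?_⟩
    rw [hfac, hd]
    ring
  · obtain ⟨k, rfl⟩ := Nat.exists_eq_add_of_lt h
    refine .inr ⟨h, eq_of_two_pow_mul_eq hodd (b := m ^ 2 - 2 * ((8 * Q + 1) * (2 ^ k * y) ^ 2))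
      (hm.pow.sub_even (even_two_mul _)) ?_⟩
    rw [hfac, hd]
    ring

lemma symbolFormula_two_of_valuation_gt_of_even (hy : Odd y)
    (hrel : 2 * c ^ 2 + c + 2 * d ^ 2 = 2 * ξ ^ 2 + ξ + (8 * Q + 1) * (2 ^ s * y) ^ 2)
    {n δ : ℤ} {k g : ℕ} (hs : s = k + g + 1) (hn : Odd n) (hv : ξ - c = 2 ^ (2 * s) * n)
    (hd : d = 2 ^ (s + k) * (4 * δ + 1)) (hcop : IsCoprime n d) : SymbolFormula Q ξ y c d s 2 := by
  obtain ⟨m, hm⟩ := exists_sq_eq_eight_mul_add_one hy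
  have hquot := quotient_rel hrel hv (D := 2 ^ k * (4 * δ + 1)) (by rw [hd]; ring)
  obtain ⟨T, hT⟩ : ∃ T, n + 1 = 2 * (2 ^ k) ^ 2 + 4 * T := by
    obtain ⟨A, rfl⟩ := hn
    refine ⟨-2 * A * ξ - ξ + 2 * (2 ^ k * 2 ^ g) ^ 2 * (2 * A + 1) ^ 2 +
      (2 ^ k) ^ 2 * (8 * δ ^ 2 + 4 * δ) - 16 * Q * m - 2 * Q - 2 * m, ?_⟩
    rw [hm, hs] at hquot
    linear_combination hquot
  subst hs
  refine symbolFormula_two_of_valuation_gt (e := k + g + 1 + k) (g := g) (δ := δ) hy hrel hn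
    (by rw [hv]; ring) hd hcop ?_
  obtain ⟨A, rfl⟩ := hn
  refine Int.modEq_iff_dvd.2
    ⟨2 ^ g * ((2 ^ k) ^ 2 * (k + g + 1 - A) - T * (2 * A + 1)), ?_⟩
  push_cast
  linear_combination -2 ^ g * (2 * A + 1) * hT

lemma symbolFormula_two_of_valuation_gt_of_odd (hy : Odd y)
    (hrel : 2 * c ^ 2 + c + 2 * d ^ 2 = 2 * ξ ^ 2 + ξ + (8 * Q + 1) * (2 ^ s * y) ^ 2)
    {n δ : ℤ} {e : ℕ} (hn : Odd n) (hv : ξ - c = 2 ^ (2 * e + 1) * n)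
    (hd : d = 2 ^ e * (4 * δ + 1)) (hcop : IsCoprime n d) : SymbolFormula Q ξ y c d s 2 := by
  obtain ⟨w, hw⟩ := two_dvd_mul_two_pow e
  refine symbolFormula_two_of_valuation_gt (e := e) (g := e) hy hrel hn
    (by rw [hv]; ring) hd hcop ?_
  obtain ⟨A, rfl⟩ := hn
  exact Int.modEq_iff_dvd.2 ⟨-2 ^ e * A * (A + 1 + s) + w * (2 * A + 1),
    by linear_combination 2 * (2 * A + 1) * hw⟩

lemma symbolFormula_two (hy : Odd y)
    (hrel : 2 * c ^ 2 + c + 2 * d ^ 2 = 2 * ξ ^ 2 + ξ + (8 * Q + 1) * (2 ^ s * y) ^ 2)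
    {δ : ℤ} {e : ℕ} (hd : d = 2 ^ e * (4 * δ + 1)) (hcop : IsCoprime (4 * δ + 1) (ξ - c)) :
    SymbolFormula Q ξ y c d s 2 := by
  have hne : ξ - c ≠ 0 := fun h => by
    have hval : 2 * e + 1 = 2 * s := eq_of_two_pow_mul_eq (odd_four_mul_add_one δ).pow
      ((odd_eight_mul_add_one Q).mul hy.pow) (a := (4 * δ + 1) ^ 2) (b := (8 * Q + 1) * y ^ 2) (by
        obtain rfl : ξ = c := sub_eq_zero.1 h
        rw [hd] at hrel
        linear_combination hrel)
    omega
  obtain ⟨v, n, hv, hn⟩ := exists_eq_two_pow_mul_odd_int hne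
  have hnd : IsCoprime n d := by
    rw [hv] at hcop
    rw [hd]
    exact (Int.isCoprime_two_right.2 hn).pow_right.mul_right hcop.of_mul_right_right.symm
  rcases valuation_sub_of_rel hy hrel hv hn hd (odd_four_mul_add_one δ) with ⟨hse, rfl⟩ | ⟨-, rfl⟩
  · obtain ⟨k, rfl⟩ := Nat.exists_eq_add_of_le hse
    rcases lt_trichotomy k s with h | rfl | h
    · obtain ⟨g, hg⟩ := Nat.exists_eq_add_of_lt h
      exact symbolFormula_two_of_valuation_gt_of_even hy hrel hg hn hv hd hnd
    · exact symbolFormula_two_of_valuation_eq (δ := δ) hy hrel hn hv (by rw [hd]; ring) hnd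
    · obtain ⟨g, rfl⟩ := Nat.exists_eq_add_of_lt h
      exact symbolFormula_two_of_valuation_lt (G := 2 ^ g * (4 * δ + 1)) hy hrel hn hv
        (by rw [hd]; ring) hnd
  · exact symbolFormula_two_of_valuation_gt_of_odd hy hrel hn hv hd hnd

theorem exists_symbolFormula (hy : Odd y)
    (hrel : 2 * c ^ 2 + c + 2 * d ^ 2 = 2 * ξ ^ 2 + ξ + (8 * Q + 1) * (2 ^ s * y) ^ 2)
    {δ : ℤ} {e : ℕ} (hd : d = 2 ^ e * (4 * δ + 1))
    (hcop : IsCoprime (4 * c + 1) (4 * ξ + 1 + 4 * d) ∨ IsCoprime (4 * c + 1) (4 * ξ + 1 - 4 * d) ∨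
      IsCoprime (4 * δ + 1) (2 * (ξ + c) + 1) ∨ IsCoprime (4 * δ + 1) (ξ - c)) :
    ∃ j, SymbolFormula Q ξ y c d s j := by
  rcases hcop with h | h | h | h
  · exact ⟨-1, SymbolFormula.neg hy (symbolFormula_one hy (by rw [neg_sq, hrel])
      (by rwa [mul_neg, sub_neg_eq_add]))⟩
  · exact ⟨1, symbolFormula_one hy hrel h⟩
  · refine ⟨0, symbolFormula_zero hy hrel ?_⟩
    rw [hd]
    exact (Int.isCoprime_two_right.2 (odd_two_mul_add_one _)).pow_right.mul_right h.symm
  · exact ⟨2, symbolFormula_two hy hrel hd h⟩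

end NormRelation

/-! ### The two power residues -/

lemma map_iPow {K : Type*} [Field K] (f : GaussianInt →+* K) (k : ℤ) :
    f (iPow k) = f ⟨0, 1⟩ ^ k := by
  have h := congrArg Units.val (map_zpow (Units.map (f : GaussianInt →* K)) iUnit k)
  rwa [Units.coe_map, Units.val_zpow_eq_zpow_val] at h

lemma map_mk_eq_div {K : Type*} [Field K] (f : GaussianInt →+* K) {a b : ℤ} (ha : (a : K) ≠ 0)
    (hf : f ⟨0, 1⟩ = b / a) (c d : ℤ) : f ⟨c, d⟩ = ((a * c + b * d : ℤ) : K) / a := by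
  have h : (⟨c, d⟩ : GaussianInt) = (c : GaussianInt) + (d : GaussianInt) * ⟨0, 1⟩ := by
    ext <;> simp
  rw [h, map_add, map_mul, map_intCast, map_intCast, hf]
  push_cast
  field_simp

section Field

variable {p : ℕ} [Fact p.Prime]

lemma two_ne_zero_zmod (hp : Odd p) : (2 : ZMod p) ≠ 0 :=
  Ring.two_ne_zero (by rw [ZMod.ringChar_zmod_n]; rintro rfl; exact absurd hp (by decide))

lemma div_zpow_eq_div_zpow_iff (hp : Odd p) {a b : ℤ} (h : (p : ℤ) = a ^ 2 + b ^ 2) {m n : ℤ} :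
    ((b : ZMod p) / a) ^ m = ((b : ZMod p) / a) ^ n ↔ m ≡ n [ZMOD 4] := by
  obtain ⟨-, f, hf, -⟩ := exists_hom_zmod ((norm_mk a b).trans h.symm)
  rw [← hf, ← map_iPow, ← map_iPow, map_iPow_inj f (two_ne_zero_zmod hp)]

variable {ϖ : GaussianInt} (hN : ϖ.norm = p) {f : GaussianInt →+* ZMod p} (hf : f ϖ = 0)
include hN hf

lemma map_pow_eq_map_quarticSym (hp : Odd p) (β : GaussianInt) :
    f β ^ ((p - 1) / 4) = f (quarticSym ϖ β) := by
  have hprime : Prime ϖ := prime_of_norm_prime Fact.out hN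
  have hodd : Odd ϖ.norm := by rw [hN]; exact_mod_cast hp
  rw [quarticSym_of_prime hprime, ← map_pow_eq_map_primeSym hprime hodd hf, hN, Int.natAbs_natCast]

lemma map_iPow_eq_div_pow (hp : Odd p) {β : GaussianInt} {k : ℤ}
    (hk : quarticSym (p : GaussianInt) β = iPow k) :
    f (iPow k) = (f β / f (star β)) ^ ((p - 1) / 4) := by
  have hprime : Prime ϖ := prime_of_norm_prime Fact.out hN
  have hodd : Odd ϖ.norm := by rw [hN]; exact_mod_cast hp
  have hsym {γ : GaussianInt} (h : quarticSym ϖ γ ≠ 0) : ∃ l, quarticSym ϖ γ = iPow l := by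
    rw [quarticSym_of_prime hprime] at h ⊢
    exact (exists_primeSym_eq_iPow hprime hodd (mt (primeSym_eq_zero hprime hodd) h)).imp
      fun _ => And.left
  have h0 := (isUnit_iPow k).ne_zero
  rw [← hk, ← mul_star_of_norm_eq hN, quarticSym_mul_star_left hodd] at h0 ⊢
  obtain ⟨B, hB⟩ := hsym (star_ne_zero.1 (right_ne_zero_of_mul h0))
  rw [div_pow, map_pow_eq_map_quarticSym hN hf hp, map_pow_eq_map_quarticSym hN hf hp, hB,
    star_iPow, map_mul, map_iPow f (-B), map_iPow f B, zpow_neg, div_eq_mul_inv]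

/-- `n * (ρ + n) ≡ ρ * star (ρ + n)` modulo `p` because `N(ρ) ≡ n ^ 2`, so `ρ / star ρ` is the
square of `(ρ + n) / star (ρ + n)`. -/
lemma div_pow_eq_map_iPow (h8 : p % 8 = 1) {ρ : GaussianInt} {n k : ℤ}
    (hρ : (p : ℤ) ∣ ρ.norm - n ^ 2) (hn : ¬ (p : ℤ) ∣ n)
    (hk : quarticSym (p : GaussianInt) (ρ + n) = iPow k) :
    (f ρ / f (star ρ)) ^ ((p - 1) / 8) = f (iPow k) := by
  have hn0 : (n : ZMod p) ≠ 0 := fun h => hn ((ZMod.intCast_zmod_eq_zero_iff_dvd _ _).1 h)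
  have hprod : f ρ * f (star ρ) = (n : ZMod p) ^ 2 := by
    have h := (ZMod.intCast_zmod_eq_zero_iff_dvd _ p).2 hρ
    rw [← map_mul, ← Zsqrtd.norm_eq_mul_conj, map_intCast, ← sub_eq_zero]
    exact_mod_cast h
  have hstar : f (star ρ) ≠ 0 := fun h => pow_ne_zero 2 hn0 (by rw [← hprod, h, mul_zero])
  have hmul : n * f (ρ + n) = f ρ * f (star (ρ + n)) := by
    rw [star_add, star_intCast, map_add, map_add, map_intCast]
    linear_combination -hprod
  have hpow := map_iPow_eq_div_pow hN hf (Nat.odd_iff.2 (by omega)) hk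
  have hne : f (star (ρ + n)) ≠ 0 := by
    intro h
    rw [h, div_zero, zero_pow (by have := (Fact.out : p.Prime).two_le; omega)] at hpow
    exact ((isUnit_iPow k).map f).ne_zero hpow
  have hsq : f ρ / f (star ρ) = (f (ρ + n) / f (star (ρ + n))) ^ 2 := by
    rw [show f (ρ + n) / f (star (ρ + n)) = f ρ / n by field_simp; linear_combination hmul,
      div_pow, ← hprod]
    field_simp
  rw [hsq, ← pow_mul, show 2 * ((p - 1) / 8) = (p - 1) / 4 by omega, hpow]

lemma div_pow_eq_zpow {Q : ℤ} (hQ : (p : ℤ) = 8 * Q + 1) {ρ : GaussianInt} {n j T : ℤ}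
    (hρ : (p : ℤ) ∣ ρ.norm - n ^ 2) (hn : ¬ (p : ℤ) ∣ n)
    (hT : quarticSym (p : GaussianInt) (iPow j * ρ + n) = iPow (T + 2 * Q * j)) :
    (f ρ / f (star ρ)) ^ ((p - 1) / 8) = f ⟨0, 1⟩ ^ T := by
  have hnorm : (iPow j * ρ).norm = ρ.norm := by
    rw [Zsqrtd.norm_mul, (Zsqrtd.norm_eq_one_iff' (by norm_num) _).2 (isUnit_iPow j), one_mul]
  have hi : f ⟨0, 1⟩ ≠ 0 := by rw [← iPow_one]; exact ((isUnit_iPow 1).map f).ne_zero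
  have h := div_pow_eq_map_iPow hN hf (by omega) (by rwa [hnorm]) hn hT
  rw [star_mul', map_mul, map_mul, star_iPow, mul_div_mul_comm, mul_pow, map_iPow, map_iPow,
    map_iPow, ← zpow_sub₀ hi, ← zpow_natCast, ← zpow_mul, zpow_add₀ hi, mul_comm,
    show (j - -j) * ((p - 1) / 8 : ℕ) = 2 * Q * j by
      rw [show (((p - 1) / 8 : ℕ) : ℤ) = Q by omega]; ring] at h
  exact mul_right_cancel₀ (zpow_ne_zero _ hi) h

lemma neg_pow_eq_map_iPow {P q n W X : ℤ} {w : GaussianInt} (hP : (p : ℤ) = 8 * P + 1)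
    (hw : w ^ 2 * (iPow 1 * -q) = n ^ 2 - p) (hW : quarticSym ϖ w = iPow W)
    (hX : quarticSym ϖ n = iPow X) : (-q : ZMod p) ^ ((p - 1) / 8) = f (iPow (X - W - P)) := by
  have key := congrArg (fun z => f z ^ ((p - 1) / 8)) hw
  simp only [map_mul, map_sub, map_neg, map_pow, map_natCast, CharP.cast_eq_zero, sub_zero,
    mul_pow, ← pow_mul, show 2 * ((p - 1) / 8) = (p - 1) / 4 by omega,
    map_pow_eq_map_quarticSym hN hf (Nat.odd_iff.2 (by omega)), hX, hW, ← mul_assoc] at key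
  rw [← map_pow, ← iPow_mul, ← map_mul, ← iPow_add, map_intCast,
    show (1 : ℤ) * ((p - 1) / 8 : ℕ) = P by omega] at key
  refine mul_left_cancel₀ ((isUnit_iPow (W + P)).map f).ne_zero (key.trans ?_)
  rw [← map_mul, ← iPow_add]
  congr 2
  ring

end Field

lemma quarticSym_mk_four_mul_intCast (c d : ℤ) {m : ℤ} (hm : Odd m) :
    quarticSym ⟨4 * c + 1, 4 * d⟩ (m : GaussianInt) =
      quarticSym (m : GaussianInt) ⟨4 * c + 1, 4 * d⟩ := by
  have hm2 : (m - 1) * (2 * d) ≡ 0 [ZMOD 4] := by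
    obtain ⟨k, rfl⟩ := hm
    exact Int.modEq_zero_iff_dvd.2 ⟨k * d, by ring⟩
  have h := quarticSym_mk_intCast (2 * c) (2 * d) hm
  rwa [iPow_congr hm2, iPow_zero, mul_one, ← mul_assoc, ← mul_assoc] at h

lemma quarticSym_mk_one_sub_i_mul_two_pow {c d y : ℤ} (t : ℕ)
    (hcop : IsCoprime (4 * c + 1) (4 * d)) (hy : Odd y) :
    quarticSym ⟨4 * c + 1, 4 * d⟩ (⟨1, -1⟩ * (2 ^ t * (y : GaussianInt))) =
      iPow (2 * t * d - c - d) * quarticSym (y : GaussianInt) ⟨4 * c + 1, 4 * d⟩ := by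
  have hmk : (⟨4 * c + 1, 4 * d⟩ : GaussianInt) = ⟨2 * (2 * c) + 1, 2 * (2 * d)⟩ := by
    congr 1 <;> ring
  have hodd := odd_norm_mk (2 * c) (2 * d)
  have htwo := quarticSym_mk_two (2 * c) (2 * d) (by convert hcop using 1 <;> ring)
  rw [← hmk] at hodd htwo
  rw [quarticSym_mul_right hodd, quarticSym_mul_right hodd, quarticSym_pow hodd,
    quarticSym_one_sub_i_of_mod_four c d hcop, htwo, quarticSym_mk_four_mul_intCast c d hy,
    ← iPow_mul, ← mul_assoc, ← iPow_add]
  exact congrArg (· * _) (iPow_congr (Int.modEq_iff_dvd.2 ⟨-2 * c * d * t, by ring⟩))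

lemma exists_quarticSym_intCast_eq_iPow {n A B : ℤ} (hn : Odd n) (h : IsCoprime n (A ^ 2 + B ^ 2)) :
    ∃ k, quarticSym (n : GaussianInt) ⟨A, B⟩ = iPow k := by
  have hnorm : ((A ^ 2 + B ^ 2 : ℤ) : GaussianInt) = ⟨A, B⟩ * star ⟨A, B⟩ := by
    rw [← Zsqrtd.norm_eq_mul_conj, norm_mk]
  have hcop := h.map (Int.castRingHom GaussianInt)
  rw [eq_intCast, eq_intCast, hnorm] at hcop
  exact exists_quarticSym_eq_iPow (odd_norm_intCast.2 hn) hcop.of_mul_right_left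

lemma isCoprime_of_sq_lt {p : ℕ} (hp : p.Prime) {z : ℤ} (hz : z ≠ 0) (h : z ^ 2 < p) :
    IsCoprime z p := by
  refine ((Nat.prime_iff_prime_int.1 hp).coprime_iff_not_dvd.2 fun hd => ?_).symm
  have hle := Int.le_of_dvd (abs_pos.2 hz) ((dvd_abs _ _).2 hd)
  rw [← sq_abs] at h
  nlinarith [Int.one_le_abs hz]

lemma two_mul_sq_add_modEq_of_rel {c d ξ Q u : ℤ}
    (hrel : 2 * c ^ 2 + c + 2 * d ^ 2 = 2 * ξ ^ 2 + ξ + (8 * Q + 1) * u ^ 2) :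
    2 * c ^ 2 + 2 * d ^ 2 + 2 * (d + u) ≡ 2 * ξ [ZMOD 4] := by
  have key : ∀ c d ξ Q u : ZMod 4, 2 * c ^ 2 + c + 2 * d ^ 2 = 2 * ξ ^ 2 + ξ + (8 * Q + 1) * u ^ 2 →
    2 * c ^ 2 + 2 * d ^ 2 + 2 * (d + u) = 2 * ξ := by decide
  have h := congrArg (Int.cast : ℤ → ZMod 4) hrel
  push_cast at h
  refine (ZMod.intCast_eq_intCast_iff _ _ 4).1 ?_
  push_cast
  exact key _ _ _ _ _ h

section Exponent

variable {p q : ℕ} {c d ξ y Q X Y : ℤ} {s : ℕ}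

lemma div_pow_eq_div_zpow [Fact q.Prime] {a b j : ℤ} (hq : (q : ℤ) = a ^ 2 + b ^ 2)
    (hQ : (q : ℤ) = 8 * Q + 1) (hp : (p : ℤ) = (4 * c + 1) ^ 2 + (4 * d) ^ 2)
    (hpξ : (p : ℤ) = (4 * ξ + 1) ^ 2 + 2 * q * (2 * (2 ^ s * y)) ^ 2)
    (hξ : ¬ (q : ℤ) ∣ 4 * ξ + 1) (hform : SymbolFormula Q ξ y c d s j)
    (hX : quarticSym ((4 * ξ + 1 : ℤ) : GaussianInt) ⟨4 * c + 1, 4 * d⟩ = iPow X)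
    (hY : quarticSym (y : GaussianInt) ⟨4 * c + 1, 4 * d⟩ = iPow Y) :
    (((a * (4 * c + 1) + b * (4 * d) : ℤ) : ZMod q) /
        ((a * (4 * c + 1) - b * (4 * d) : ℤ) : ZMod q)) ^ ((q - 1) / 8) =
      ((b : ZMod q) / a) ^ (X - Y + (d - 2 * ξ - 2 * (s + 1) * d)) := by
  have hN : (⟨a, b⟩ : GaussianInt).norm = q := by rw [norm_mk, hq]
  obtain ⟨ha, g, hgi, hg⟩ := exists_hom_zmod hN
  change (a : ZMod q) ≠ 0 at ha
  change g ⟨0, 1⟩ = (b : ZMod q) / a at hgi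
  have hdvd : (q : ℤ) ∣ (⟨4 * c + 1, 4 * d⟩ : GaussianInt).norm - (4 * ξ + 1) ^ 2 :=
    ⟨2 * (2 * (2 ^ s * y)) ^ 2, by rw [norm_mk, ← hp, hpξ]; ring⟩
  have hT : quarticSym (q : GaussianInt)
      (iPow j * ⟨4 * c + 1, 4 * d⟩ + ((4 * ξ + 1 : ℤ) : GaussianInt)) =
      iPow (X - Y + (d - 2 * ξ - 2 * (s + 1) * d) + 2 * Q * j) := by
    rw [SymbolFormula, hX, hY, ← hQ, Int.cast_natCast, ← iPow_add] at hform
    refine mul_right_cancel₀ (isUnit_iPow Y).ne_zero (hform.trans ?_)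
    rw [← iPow_add]
    congr 1
    ring
  have h := div_pow_eq_zpow hN hg hQ hdvd hξ hT
  rwa [show star (⟨4 * c + 1, 4 * d⟩ : GaussianInt) = ⟨4 * c + 1, -(4 * d)⟩ from rfl,
    map_mk_eq_div g ha hgi, map_mk_eq_div g ha hgi, div_div_div_cancel_right₀ ha, mul_neg,
    ← sub_eq_add_neg, hgi] at h

variable [Fact p.Prime]

lemma neg_pow_eq_neg_one_pow_mul_zpow (hp : (p : ℤ) = (4 * c + 1) ^ 2 + (4 * d) ^ 2)
    (hpξ : (p : ℤ) = (4 * ξ + 1) ^ 2 + 2 * q * (2 * (2 ^ s * y)) ^ 2) (hQ : (q : ℤ) = 8 * Q + 1)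
    (hy : Odd y) (hcop : IsCoprime (4 * c + 1) (4 * d))
    (hX : quarticSym ((4 * ξ + 1 : ℤ) : GaussianInt) ⟨4 * c + 1, 4 * d⟩ = iPow X)
    (hY : quarticSym (y : GaussianInt) ⟨4 * c + 1, 4 * d⟩ = iPow Y) :
    (-(q : ZMod p)) ^ ((p - 1) / 8) = (-1) ^ (d + 2 ^ s * y) *
      (((4 * d : ℤ) : ZMod p) / ((4 * c + 1 : ℤ) : ZMod p)) ^
        (X - Y + (d - 2 * ξ - 2 * (s + 1) * d)) := by
  have hN : (⟨4 * c + 1, 4 * d⟩ : GaussianInt).norm = p := by rw [norm_mk, hp]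
  have hrel : 2 * c ^ 2 + c + 2 * d ^ 2 = 2 * ξ ^ 2 + ξ + (8 * Q + 1) * (2 ^ s * y) ^ 2 := by
    rw [hQ] at hpξ
    linarith
  obtain ⟨-, f, hfi, hf⟩ := exists_hom_zmod hN
  have hw :
      (⟨1, -1⟩ * (2 ^ (s + 1) * (y : GaussianInt))) ^ 2 * (iPow 1 * -((q : ℤ) : GaussianInt)) =
        ((4 * ξ + 1 : ℤ) : GaussianInt) ^ 2 - p := by
    have hi : (⟨1, -1⟩ : GaussianInt) ^ 2 * iPow 1 = 2 := by rw [iPow_one]; decide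
    have hpξ' := congrArg (Int.cast : ℤ → GaussianInt) hpξ
    push_cast at hpξ' ⊢
    linear_combination hpξ' - (2 ^ (s + 1) * (y : GaussianInt)) ^ 2 * q * hi
  have hW := quarticSym_mk_one_sub_i_mul_two_pow (s + 1) hcop hy
  rw [hY, ← iPow_add] at hW
  have hpow := neg_pow_eq_map_iPow hN hf (P := 2 * c ^ 2 + c + 2 * d ^ 2) (by rw [hp]; ring) hw hW
    (by rw [quarticSym_mk_four_mul_intCast c d (odd_four_mul_add_one ξ), hX])
  have hneg (k : ℤ) : (-1 : ZMod p) ^ k = f (iPow (2 * k)) := by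
    rw [map_iPow, zpow_mul, ← map_iPow, iPow_two, map_neg, map_one]
  rw [Int.cast_natCast] at hpow
  rw [hpow, hneg, ← hfi, ← map_iPow, ← map_mul, ← iPow_add]
  obtain ⟨k, hk⟩ := (two_mul_sq_add_modEq_of_rel hrel).dvd
  refine congrArg f (iPow_congr (Int.modEq_iff_dvd.2 ⟨-k, ?_⟩))
  push_cast
  linear_combination -hk

lemma exists_common_exponent [Fact q.Prime] (hpq : p ≠ q) {a b δ : ℤ} {e : ℕ}
    (hq : (q : ℤ) = a ^ 2 + b ^ 2) (hQ : (q : ℤ) = 8 * Q + 1)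
    (hp : (p : ℤ) = (4 * c + 1) ^ 2 + (4 * d) ^ 2)
    (hpξ : (p : ℤ) = (4 * ξ + 1) ^ 2 + 2 * q * (2 * (2 ^ s * y)) ^ 2)
    (hy : Odd y) (hd : d = 2 ^ e * (4 * δ + 1))
    (hcop : IsCoprime (4 * c + 1) (4 * ξ + 1 + 4 * d) ∨ IsCoprime (4 * c + 1) (4 * ξ + 1 - 4 * d) ∨
      IsCoprime (4 * δ + 1) (2 * (ξ + c) + 1) ∨ IsCoprime (4 * δ + 1) (ξ - c)) :
    ∃ T : ℤ, (-(q : ZMod p)) ^ ((p - 1) / 8) = (-1) ^ (d + 2 ^ s * y) *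
        (((4 * d : ℤ) : ZMod p) / ((4 * c + 1 : ℤ) : ZMod p)) ^ T ∧
      (((a * (4 * c + 1) + b * (4 * d) : ℤ) : ZMod q) /
        ((a * (4 * c + 1) - b * (4 * d) : ℤ) : ZMod q)) ^ ((q - 1) / 8) =
        ((b : ZMod q) / a) ^ T := by
  have hpp : p.Prime := Fact.out
  have hqq : q.Prime := Fact.out
  have hq0 : (0 : ℤ) < q := mod_cast hqq.pos
  have hyne := ne_zero_of_odd hy
  have hdne : d ≠ 0 := by
    rw [hd]
    exact mul_ne_zero (by positivity) (ne_zero_of_odd (odd_four_mul_add_one δ))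
  have hcp : IsCoprime (4 * c + 1) (p : ℤ) :=
    isCoprime_of_sq_lt hpp (by omega) (by rw [hp]; exact lt_add_of_pos_right _ (by positivity))
  have hξp : IsCoprime (4 * ξ + 1) (p : ℤ) :=
    isCoprime_of_sq_lt hpp (by omega) (by rw [hpξ]; exact lt_add_of_pos_right _ (by positivity))
  have hyp : IsCoprime (2 * (2 ^ s * y)) (p : ℤ) := by
    have : 0 < (2 * (2 ^ s * y)) ^ 2 := by positivity
    exact isCoprime_of_sq_lt hpp (by positivity) (by nlinarith [sq_nonneg (4 * ξ + 1)])
  have hcd : IsCoprime (4 * c + 1) (4 * d) := by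
    rw [hp, sq, sq, IsCoprime.mul_add_left_right_iff] at hcp
    exact hcp.of_mul_right_left
  have hqξ : ¬ (q : ℤ) ∣ 4 * ξ + 1 := by
    intro h
    have hdvd : (q : ℤ) ∣ p := by
      rw [hpξ, mul_assoc, mul_left_comm]
      exact dvd_add (h.trans (dvd_pow_self _ two_ne_zero)) (dvd_mul_right _ _)
    exact hpq ((Nat.prime_dvd_prime_iff_eq hqq hpp).1 (Int.natCast_dvd_natCast.1 hdvd)).symm
  have hrel : 2 * c ^ 2 + c + 2 * d ^ 2 = 2 * ξ ^ 2 + ξ + (8 * Q + 1) * (2 ^ s * y) ^ 2 := by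
    rw [← hQ]
    linarith
  obtain ⟨X, hX⟩ := exists_quarticSym_intCast_eq_iPow (odd_four_mul_add_one ξ) (hp ▸ hξp)
  obtain ⟨Y, hY⟩ := exists_quarticSym_intCast_eq_iPow hy
    (hp ▸ hyp.of_mul_left_right.of_mul_left_right)
  obtain ⟨j, hform⟩ := exists_symbolFormula hy hrel hd hcop
  exact ⟨_, neg_pow_eq_neg_one_pow_mul_zpow hp hpξ hQ hy hcd hX hY,
    div_pow_eq_div_zpow hq hQ hp hpξ hqξ hform hX hY⟩

end Exponent

lemma exists_eq_add_two {c d δ : ℤ} {r : ℕ} (hp : (c ^ 2 + d ^ 2) % 8 = 1)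
    (hc : Odd c) (hd : d = 2 ^ r * δ) (hδ : Odd δ) : ∃ e, r = e + 2 := by
  have hc8 := Int.eight_dvd_sq_sub_one_of_odd hc
  obtain ⟨k, rfl⟩ : 2 ∣ d := Int.prime_two.dvd_of_dvd_pow (n := 2) (by omega)
  obtain ⟨l, rfl⟩ : 2 ∣ k := Int.prime_two.dvd_of_dvd_pow (n := 2) (by rw [mul_pow] at hp; omega)
  have hdvd : (2 : ℤ) ^ 2 ∣ 2 ^ r * δ := ⟨l, by rw [← hd]; ring⟩
  have hle := (pow_dvd_pow_iff two_ne_zero Int.prime_two.not_isUnit).1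
    ((Int.isCoprime_two_left.2 hδ).pow_left.dvd_of_dvd_mul_right hdvd)
  exact Nat.exists_eq_add_of_le' hle

lemma odd_and_even_of_mod_eight {x y q : ℤ} (hq : Odd q)
    (h : (x ^ 2 + 2 * q * y ^ 2) % 8 = 1) : Odd x ∧ Even y := by
  rw [mul_assoc] at h
  have hx : Odd x := (Int.odd_pow' two_ne_zero).1 (Int.odd_iff.2 (by omega))
  have hx8 := Int.eight_dvd_sq_sub_one_of_odd hx
  have hy : Even (q * y ^ 2) := Int.even_iff.2 (by omega)
  exact ⟨hx, Int.even_pow.1 ((Int.even_mul.1 hy).resolve_left (Int.not_even_iff_odd.2 hq)) |>.1⟩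

lemma exists_eq_or_eq_neg_of_odd {x : ℤ} (hx : Odd x) :
    ∃ ξ, x = 4 * ξ + 1 ∨ x = -(4 * ξ + 1) := by
  rcases mod_four_of_odd hx with h | h
  · exact ⟨x / 4, .inl (by omega)⟩
  · exact ⟨-x / 4, .inr (by omega)⟩

lemma exists_eq_two_mul_two_pow_mul_odd {y : ℤ} (hy : Even y) (h0 : y ≠ 0) :
    ∃ (s : ℕ) (z : ℤ), y = 2 * (2 ^ s * z) ∧ Odd z := by
  obtain ⟨u, rfl⟩ := hy.two_dvd
  obtain ⟨s, z, rfl, hz⟩ := exists_eq_two_pow_mul_odd_int (right_ne_zero_of_mul h0)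
  exact ⟨s, z, rfl, hz⟩

lemma isCoprime_of_gcd_eq_one {c d δ x ξ : ℤ} (hx : x = 4 * ξ + 1 ∨ x = -(4 * ξ + 1))
    (h : Int.gcd (4 * c + 1) (x + 4 * d) = 1 ∨ Int.gcd (4 * δ + 1) (x + (4 * c + 1)) = 1) :
    IsCoprime (4 * c + 1) (4 * ξ + 1 + 4 * d) ∨ IsCoprime (4 * c + 1) (4 * ξ + 1 - 4 * d) ∨
      IsCoprime (4 * δ + 1) (2 * (ξ + c) + 1) ∨ IsCoprime (4 * δ + 1) (ξ - c) := by
  rw [← Int.isCoprime_iff_gcd_eq_one, ← Int.isCoprime_iff_gcd_eq_one] at h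
  rcases hx with rfl | rfl <;> rcases h with h | h
  · exact .inl h
  · rw [show 4 * ξ + 1 + (4 * c + 1) = 2 * (2 * (ξ + c) + 1) by ring] at h
    exact .inr (.inr (.inl h.of_mul_right_right))
  · rw [neg_add_eq_sub, ← neg_sub, IsCoprime.neg_right_iff] at h
    exact .inr (.inl h)
  · rw [show -(4 * ξ + 1) + (4 * c + 1) = -4 * (ξ - c) by ring] at h
    exact .inr (.inr (.inr h.of_mul_right_right))

end QuarticSymbol

open QuarticSymbol

/-- All congruences of quotients are equations in the fields `ZMod p` and `ZMod q`, where every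
denominator is nonzero under the hypotheses; the hypotheses also give `4 ∣ d` and `2 ∣ y`, so that
the divisions in the exponent of `-1` are exact. -/
theorem theorem4p6 (p q : ℕ) [Fact p.Prime] [Fact q.Prime] (hpq : p ≠ q)
    (hp8 : p ≡ 1 [MOD 8]) (hq8 : q ≡ 1 [MOD 8])
    (a b c d x y d₀ : ℤ) (r : ℕ)
    (hpcd : (p : ℤ) = c ^ 2 + d ^ 2) (hpxy : (p : ℤ) = x ^ 2 + 2 * (q : ℤ) * y ^ 2)
    (hqab : (q : ℤ) = a ^ 2 + b ^ 2)
    (hc : c ≡ 1 [ZMOD 4]) (hd : d = 2 ^ r * d₀) (hd₀ : d₀ ≡ 1 [ZMOD 4])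
    (hgcd : Int.gcd c (x + d) = 1 ∨ Int.gcd d₀ (x + c) = 1) (m : ℤ) :
    (-(q : ZMod p)) ^ ((p - 1) / 8) =
        (-1 : ZMod p) ^ (d / 4 + y / 2) * ((d : ZMod p) / (c : ZMod p)) ^ m ↔
      (((a * c + b * d : ℤ) : ZMod q) / ((a * c - b * d : ℤ) : ZMod q)) ^ ((q - 1) / 8) =
        ((b : ZMod q) / (a : ZMod q)) ^ m := by
  rw [Nat.ModEq] at hp8 hq8
  obtain ⟨c, rfl⟩ : ∃ c', c = 4 * c' + 1 := ⟨c / 4, by rw [Int.ModEq] at hc; omega⟩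
  obtain ⟨δ, rfl⟩ : ∃ δ, d₀ = 4 * δ + 1 := ⟨d₀ / 4, by rw [Int.ModEq] at hd₀; omega⟩
  obtain ⟨hx, hyeven⟩ := odd_and_even_of_mod_eight (q := q) (Int.odd_iff.2 (by omega))
    (by rw [← hpxy]; omega)
  obtain ⟨e, rfl⟩ := exists_eq_add_two (by rw [← hpcd]; omega) (odd_four_mul_add_one c) hd
    (odd_four_mul_add_one δ)
  obtain ⟨d, rfl⟩ : ∃ d', d = 4 * d' := ⟨2 ^ e * (4 * δ + 1), by rw [hd]; ring⟩
  obtain ⟨ξ, hξ⟩ := exists_eq_or_eq_neg_of_odd hx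
  obtain ⟨s, y, rfl, hy⟩ := exists_eq_two_mul_two_pow_mul_odd hyeven
    (by rintro rfl; exact (Nat.prime_iff_prime_int.1 Fact.out).irreducible.not_isSquare
          ⟨x, by rw [hpxy]; ring⟩)
  have hpξ : (p : ℤ) = (4 * ξ + 1) ^ 2 + 2 * q * (2 * (2 ^ s * y)) ^ 2 := by
    rw [hpxy]; rcases hξ with rfl | rfl <;> ring
  obtain ⟨T, hpT, hqT⟩ := exists_common_exponent (Q := q / 8) (e := e) hpq hqab (by omega) hpcd hpξ
    hy (by rw [pow_add] at hd; linarith) (isCoprime_of_gcd_eq_one hξ hgcd)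
  rw [Int.mul_ediv_cancel_left _ four_ne_zero, Int.mul_ediv_cancel_left _ two_ne_zero, hpT, hqT,
    mul_right_inj' (zpow_ne_zero _ (neg_ne_zero.2 one_ne_zero)),
    div_zpow_eq_div_zpow_iff (Nat.odd_iff.2 (by omega)) hpcd,
    div_zpow_eq_div_zpow_iff (Nat.odd_iff.2 (by omega)) hqab]
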